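/- Setting. $M$ flows issue requests, numbered by $n\in\mathbb Z$ in order of arrival; request $n$ comes from flow $I_n\in\{1,\dots,M\}$ and asks for the data item $R_n$. The pairs $(I_n,R_n)$, $n\in\mathbb Z$, are i.i.d. (as they are for $M$ independent Poisson streams with i.i.d. items), and $\nu_k:=\mathbb P[I_0=k]>0$ for every $k$. Flow $k$ requests only items from its infinite list $d^{(k)}_1,d^{(k)}_2,\dots$ of distinct items; each item has a positive size. A cache keeps the items that it serves sorted by last access, most recent first, and $C_0$ denotes the total size of the items that stand in front of the item $R_0$ when request $0$ arrives; request $0$ is a miss for cache size $y$ if $C_0>y$. Under pooling, one cache of size $x$ serves all requests; the resulting probabilities are written $\mathbb P_p$. Under separation with fractions $u=(u_1,\dots,u_M)$, $u_k\ge 0$, $\sum_k u_k=1$, the requests of flow $k$ are served by a cache of their own, of size $u_kx$; the resulting probabilities are written $\mathbb P_s$, and the overall miss probability is $F_x(u)=\sum_k\nu_k\,\mathbb P_s[C_0>u_kx\mid I_0=k]$. A separation $u^*=u^*(x)$ (constant or depending on the total cache size $x$) is called optimal if it minimizes the overall miss probability asymptotically, that is, if for every fixed vector of fractions $v$ and every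 $\varepsilon>0$ one has $F_x(u^*(x))\le(1+\varepsilon)F_x(v)$ for all large $x$. Statement. Suppose that no item belongs to the lists of two different flows, that all items of all the flows have the same size, and that there are $\alpha>1$ and $c_1,\dots,c_M>0$ with $$\mathbb P\left[R_0=d^{(k)}_n\mid I_0=k\right]\sim \frac{c_k}{n^{\alpha}}\qquad(n\to\infty),\quad 1\le k\le M.$$ Then an optimal separation with constant fractions exists, and for every optimal separation $u^*$ and every flow $k$, $$\lim_{x\to\infty}\frac{\mathbb P_p[C_0>x\mid I_0=k]}{\mathbb P_s[C_0>u^*_kx\mid I_0=k]}=1 .$$ Furthermore, for any two flows $i,j$, $$\lim_{x\to\infty}\frac{\mathbb P_p[C_0>x\mid I_0=i]}{\mathbb P_p[C_0>x\mid I_0=j]}=\lim_{x\to\infty}\frac{\mathbb P_s[C_0>u^*_ix\mid I_0=i]}{\mathbb P_s[C_0>u^*_jx\mid I_0=j]}=\frac{c_i^{1/\alpha}\,\nu_i^{1/\alpha-1}}{c_j^{1/\alpha}\,\nu_j^{1/\alpha-1}} .$$ -/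

import Mathlib

open MeasureTheory ProbabilityTheory Filter Topology Asymptotics
open scoped ENNReal

noncomputable section

/-- A stationary stream of data item requests made by `M` flows (independent reference model).

The requests are numbered by `n : ℤ` in the order of their arrival; request `n` is issued by flow
`I n` and asks for the data item `R n`.  The pairs `(I n, R n)` are independent and identically
distributed.  Superposing `M` independent Poisson streams of requests with i.i.d. items gives such a
sequence, flow `k` then having `P (I n = k)` equal to its rate divided by the total rate.

Flow `k` only requests items from its own infinite list `item k 0, item k 1, …` of pairwise distinct
items (the lists are numbered from `0` here: `item k i` is the `(i + 1)`-st item of flow `k`).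
The lists of different flows may share items. -/
structure RequestModel {Ω : Type*} [MeasurableSpace Ω] (P : Measure Ω)
    (D : Type*) [MeasurableSpace D] (M : ℕ) where
  /-- the flow that issues request `n` -/
  I : ℤ → Ω → Fin M
  /-- the data item that request `n` asks for -/
  R : ℤ → Ω → D
  /-- the list of data items of each flow -/
  item : Fin M → ℕ → D
  /-- the size of a data item -/
  size : D → ℝ
  measurable_I : ∀ n, Measurable (I n)
  measurable_R : ∀ n, Measurable (R n)
  indep : iIndepFun (fun n ω => (I n ω, R n ω)) P
  identDistrib : ∀ n, IdentDistrib (fun ω => (I n ω, R n ω)) (fun ω => (I 0 ω, R 0 ω)) P P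
  flow_pos : ∀ k, P {ω | I 0 ω = k} ≠ 0
  item_injective : ∀ k, Function.Injective (item k)
  request_mem : ∀ n, ∀ᵐ ω ∂P, R n ω ∈ Set.range (item (I n ω))
  size_pos : ∀ d, 0 < size d

namespace RequestModel

variable {Ω : Type*} [MeasurableSpace Ω] {P : Measure Ω} {D : Type*} [MeasurableSpace D] {M : ℕ}

/-- `ν k = P[I₀ = k]`, the fraction of the requests that flow `k` issues. -/
def ν (X : RequestModel P D M) (k : Fin M) : ℝ := P.real {ω | X.I 0 ω = k}

/-- The popularity `P[R₀ = d | I₀ = k]` of the `(i + 1)`-st item `d` of flow `k` within flow `k`. -/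
def q (X : RequestModel P D M) (k : Fin M) (i : ℕ) : ℝ :=
  (P[|{ω | X.I 0 ω = k}]).real {ω | X.R 0 ω = X.item k i}

/-- No data item belongs to the lists of two different flows. -/
def NonOverlapping (X : RequestModel P D M) : Prop :=
  ∀ k g, k ≠ g → ∀ i j, X.item k i ≠ X.item g j

/-- Consider a cache that serves the requests with numbers in `S` only, and keeps the items sorted
by their last access (move-to-front list, most recent first).  This is the set of the items that
stand in front of the item asked for by request `n` when request `n` arrives: those requested (in
this cache) more recently than that item. -/
def inFront (X : RequestModel P D M) (S : Set ℤ) (n : ℤ) (ω : Ω) : Set D :=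
  {d | ∃ m ∈ S, m < n ∧ X.R m ω = d ∧ ∀ j ∈ S, m ≤ j → j < n → X.R j ω ≠ X.R n ω}

/-- The total size of the items in front of the requested one.  It is infinite if infinitely many
items stand there, which can only happen if the item was never requested before. -/
def searchCost (X : RequestModel P D M) (S : Set ℤ) (n : ℤ) (ω : Ω) : ℝ≥0∞ :=
  ∑' d : X.inFront S n ω, ENNReal.ofReal (X.size d)

/-- Pooling: one cache serves the requests of all flows. -/
def poolCost (X : RequestModel P D M) (n : ℤ) (ω : Ω) : ℝ≥0∞ :=
  X.searchCost Set.univ n ω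

/-- Separation: the requests of each flow are served by a cache of its own; request `n` is looked
up in the cache that serves exactly the requests of the flow `I n`. -/
def sepCost (X : RequestModel P D M) (n : ℤ) (ω : Ω) : ℝ≥0∞ :=
  X.searchCost {m | X.I m ω = X.I n ω} n ω

/-- `P_p[C₀ > x | I₀ = k]`: the miss probability of flow `k` when all the flows share one cache of
size `x`. -/
def poolMiss (X : RequestModel P D M) (k : Fin M) (x : ℝ) : ℝ :=
  (P[|{ω | X.I 0 ω = k}]).real {ω | ENNReal.ofReal x < X.poolCost 0 ω}

/-- `P_s[C₀ > y | I₀ = k]`: the miss probability of flow `k` when it is served alone by a cache of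
size `y`. -/
def sepMiss (X : RequestModel P D M) (k : Fin M) (y : ℝ) : ℝ :=
  (P[|{ω | X.I 0 ω = k}]).real {ω | ENNReal.ofReal y < X.sepCost 0 ω}

/-- `P_s[C₀ > x]`: the overall miss probability when the cache space `x` is divided among the flows
according to the fractions `u`, flow `k` getting a cache of size `u k * x`. -/
def overallSepMiss (X : RequestModel P D M) (u : Fin M → ℝ) (x : ℝ) : ℝ :=
  P.real {ω | ENNReal.ofReal (u (X.I 0 ω) * x) < X.sepCost 0 ω}

/-- `u x` are the fractions by which a cache space of size `x` is divided.  The separation `u` is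
optimal if it minimizes the overall miss probability asymptotically as `x → ∞`: no fixed fractions
`v` do better by more than a factor tending to `1`.  The fractions `u x` may but need not depend on
`x`; in particular, fixed optimal fractions are covered (constant `u`), and so are exact minimizers
of the overall miss probability for each `x`. -/
def IsOptimalSeparation (X : RequestModel P D M) (u : ℝ → Fin M → ℝ) : Prop :=
  (∀ x, 0 < x → u x ∈ stdSimplex ℝ (Fin M)) ∧
    ∀ v ∈ stdSimplex ℝ (Fin M), ∀ ε : ℝ, 0 < ε →
      ∀ᶠ x in atTop, X.overallSepMiss (u x) x ≤ (1 + ε) * X.overallSepMiss v x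

end RequestModel

end

/-! Put `a k = (ν k * c k) ^ (1 / α)` and `A = ∑ k, a k`. Let a cache serve the flows `G`. Among the
last `T` requests, the number of distinct items of `G` concentrates near its Poissonized mean, which
is asymptotic to `L * (∑ g ∈ G, a g) * T ^ (1 / α)`. The item asked for by flow `k` is absent from
these requests with probability asymptotic to `J * (a k / ν k) * T ^ (1 / α - 1)`. Here `L` and `J`
are integrals depending on `α` only (`tendsto_rpow_mul_tsum`).

A miss for size `x` essentially means that the item is absent from the last `T` requests, where `T`
is the horizon at which the distinct items fill the cache. Hence `x ^ (α - 1)` times the miss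
probability tends to `K * (a k / ν k) * (∑ g ∈ G, a g) ^ (α - 1)` with one constant `K` for all
flows (`CostBounds.tendsto_miss`). The horizon is perturbed by a factor, and a Chernoff bound makes
the error exponentially small (`tendsto_rpow_mul_miss`). The bound comes from Poissonization, which
makes the occurrences of different items independent at the price of a factor at most `e * T`
(`poissonLoss_le`).

Pooling is `G = univ`, separation is `G = {k}`. The rescaled overall miss probability under positive
fractions `u` tends to `K * ∑ k, a k ^ α * u k ^ (1 - α)`. This is strictly convex and minimal
exactly at `u k = a k / A`; compactness of the simplex forces every optimal separation to converge
there (`tendsto_of_optimal`). At these fractions the separate limits are `K * (a k / ν k) * A ^ (α -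
1)`, the pooled ones, and `a k / ν k = c k ^ (1 / α) * ν k ^ (1 / α - 1)`. -/

/-! ### Sums over power-law popularities as integrals. -/

theorem integral_comp_natFloor {f : ℕ → ℝ} (hf : Summable f) (hf0 : ∀ i, 0 ≤ f i) :
    ∫ z in Set.Ioi (0 : ℝ), f ⌊z⌋₊ = ∑' i, f i := by
  have hU : (⋃ n : ℕ, Set.Ico (n : ℝ) (n + 1)) = Set.Ici 0 := by
    ext z
    simp only [Set.mem_iUnion, Set.mem_Ico, Set.mem_Ici]
    constructor
    · rintro ⟨n, h, -⟩
      exact (Nat.cast_nonneg n).trans h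
    · intro hz
      exact ⟨⌊z⌋₊, Nat.floor_le hz, Nat.lt_floor_add_one z⟩
  have hconst : ∀ n : ℕ, Set.EqOn (fun z : ℝ => f ⌊z⌋₊) (fun _ => f n) (Set.Ico (n : ℝ) (n + 1)) := by
    intro n z hz
    have : ⌊z⌋₊ = n := (Nat.floor_eq_iff ((Nat.cast_nonneg n).trans hz.1)).2 hz
    simp only [this]
  have hint : ∀ n : ℕ, ∫ z in Set.Ico (n : ℝ) (n + 1), f ⌊z⌋₊ = f n := by
    intro n
    rw [setIntegral_congr_fun measurableSet_Ico (hconst n)]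
    simp
  have hmeas : ∀ n : ℕ, MeasurableSet (Set.Ico (n : ℝ) (n + 1)) := fun _ => measurableSet_Ico
  have hon : ∀ n : ℕ, IntegrableOn (fun z : ℝ => f ⌊z⌋₊) (Set.Ico (n : ℝ) (n + 1)) := by
    intro n
    rw [integrableOn_congr_fun (hconst n) measurableSet_Ico]
    exact integrableOn_const (by simp)
  have hI : IntegrableOn (fun z : ℝ => f ⌊z⌋₊) (⋃ n : ℕ, Set.Ico (n : ℝ) (n + 1)) := by
    refine integrableOn_iUnion_of_summable_integral_norm hon ?_
    simpa only [Real.norm_of_nonneg (hf0 _), hint] using hf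
  have hd : Pairwise (Function.onFun Disjoint fun n : ℕ => Set.Ico (n : ℝ) (n + 1)) := by
    intro m n hmn
    refine Set.disjoint_left.2 fun z hm hn => hmn ?_
    have h0 : (0 : ℝ) ≤ z := (Nat.cast_nonneg m).trans hm.1
    exact ((Nat.floor_eq_iff h0).2 hm).symm.trans ((Nat.floor_eq_iff h0).2 hn)
  have h := hasSum_integral_iUnion hmeas hd hI
  simp only [hint] at h
  rw [← integral_Ici_eq_integral_Ioi, ← hU, ← h.tsum_eq]

theorem integrableOn_min_one_rpow {α : ℝ} (hα : 1 < α) {C : ℝ} (hC : 0 ≤ C) :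
    IntegrableOn (fun z : ℝ => min 1 (C * z ^ (-α))) (Set.Ioi 0) := by
  have hm : Measurable fun z : ℝ => min 1 (C * z ^ (-α)) := by fun_prop
  have hnn : ∀ z ∈ Set.Ioi (0 : ℝ), 0 ≤ min 1 (C * z ^ (-α)) := fun z hz =>
    le_min zero_le_one (mul_nonneg hC (Real.rpow_nonneg (le_of_lt hz) _))
  rw [← Set.Ioc_union_Ioi_eq_Ioi zero_le_one]
  refine IntegrableOn.union ?_ ?_
  · refine Integrable.mono' (g := fun _ => (1 : ℝ)) (integrableOn_const (by simp))
      hm.aestronglyMeasurable ?_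
    refine (ae_restrict_iff' measurableSet_Ioc).2 (.of_forall fun z hz => ?_)
    rw [Real.norm_of_nonneg (hnn z hz.1)]
    exact min_le_left _ _
  · refine Integrable.mono' (g := fun z : ℝ => C * z ^ (-α))
      ((integrableOn_Ioi_rpow_of_lt (by linarith) zero_lt_one).const_mul C)
      hm.aestronglyMeasurable ?_
    refine (ae_restrict_iff' measurableSet_Ioi).2 (.of_forall fun z hz => ?_)
    rw [Real.norm_of_nonneg (hnn z (lt_trans zero_lt_one (Set.mem_Ioi.1 hz)))]
    exact min_le_right _ _

theorem exists_le_mul_rpow {α : ℝ} {p : ℕ → ℝ} {a : ℝ}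
    (hp : p ~[atTop] fun i : ℕ => a / ((i : ℝ) + 1) ^ α) :
    ∃ C, 0 < C ∧ ∀ i, p i ≤ C * ((i : ℝ) + 1) ^ (-α) := by
  have h1 : p =O[atTop] fun i : ℕ => ((i : ℝ) + 1) ^ (-α) := by
    refine hp.isBigO.trans (IsBigO.of_bound |a| (.of_forall fun i => ?_))
    have hi : (0 : ℝ) < (i : ℝ) + 1 := by positivity
    rw [Real.rpow_neg hi.le, norm_div, div_eq_mul_inv, Real.norm_eq_abs a, norm_inv]
  obtain ⟨C, hC, h⟩ := bound_of_isBigO_nat_atTop h1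
  refine ⟨C, hC, fun i => ?_⟩
  have hi : (0 : ℝ) < ((i : ℝ) + 1) ^ (-α) := by positivity
  have := h hi.ne'
  rw [Real.norm_of_nonneg hi.le] at this
  exact (le_abs_self _).trans this

theorem summable_add_one_rpow_neg {α : ℝ} (hα : 1 < α) :
    Summable fun i : ℕ => ((i : ℝ) + 1) ^ (-α) := by
  have := (summable_nat_add_iff 1).2 (Real.summable_nat_rpow.2 (show -α < -1 by linarith))
  simpa using this

/-- Sums over items with popularities `p i ∼ a / (i + 1) ^ α`, rescaled to integrals. -/
theorem tendsto_rpow_mul_tsum {α : ℝ} (hα : 1 < α) {p : ℕ → ℝ} (hp0 : ∀ i, 0 ≤ p i)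
    (hp1 : ∀ i, p i ≤ 1) {a : ℝ} (ha : 0 < a)
    (hp : p ~[atTop] fun i : ℕ => a / ((i : ℝ) + 1) ^ α) {H : ℕ → ℝ → ℝ} {h : ℝ → ℝ}
    (hH0 : ∀ T r, 0 ≤ r → r ≤ 1 → 0 ≤ H T r) (hH1 : ∀ T r, 0 ≤ r → r ≤ 1 → H T r ≤ 1)
    (hHr : ∀ T r, 0 ≤ r → r ≤ 1 → H T r ≤ T * r)
    (hlim : ∀ (y : ℝ) (r : ℕ → ℝ), 0 < y → Tendsto (fun T : ℕ => T * r T) atTop (𝓝 y) →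
      Tendsto (fun T => H T (r T)) atTop (𝓝 (h y))) :
    Tendsto (fun T : ℕ => (T : ℝ) ^ (-(1 / α)) * ∑' i, H T (p i)) atTop
      (𝓝 (a ^ (1 / α) * ∫ z in Set.Ioi (0 : ℝ), h (z ^ (-α)))) := by
  have hα0 : 0 < α := by linarith
  obtain ⟨C, hC, hpC⟩ := exists_le_mul_rpow hp
  have hsum : ∀ T, Summable fun i => H T (p i) := by
    intro T
    refine Summable.of_nonneg_of_le (fun i => hH0 T _ (hp0 i) (hp1 i))
      (fun i => (hHr T _ (hp0 i) (hp1 i)).trans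
        (mul_le_mul_of_nonneg_left (hpC i) (Nat.cast_nonneg T))) ?_
    exact ((summable_add_one_rpow_neg hα).mul_left C).mul_left _
  -- rewriting the sum as an integral
  have heq : ∀ᶠ T : ℕ in atTop, ∫ z in Set.Ioi (0 : ℝ), H T (p ⌊(T : ℝ) ^ (1 / α) * z⌋₊) =
      (T : ℝ) ^ (-(1 / α)) * ∑' i, H T (p i) := by
    filter_upwards [eventually_gt_atTop 0] with T hT
    have hT' : (0 : ℝ) < T := by exact_mod_cast hT
    have := integral_comp_mul_left_Ioi (fun z => H T (p ⌊z⌋₊)) 0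
      (show (0 : ℝ) < (T : ℝ) ^ (1 / α) by positivity)
    rw [this, mul_zero, integral_comp_natFloor (hsum T) fun i => hH0 T _ (hp0 i) (hp1 i),
      smul_eq_mul, Real.rpow_neg hT'.le]
  -- The constant `a` is absorbed by the substitution `z ↦ a ^ (-1 / α) * z`.
  have hscale : a ^ (1 / α) * ∫ z in Set.Ioi (0 : ℝ), h (z ^ (-α)) =
      ∫ z in Set.Ioi (0 : ℝ), h (a * z ^ (-α)) := by
    have hb : (0 : ℝ) < (a ^ (1 / α))⁻¹ := by positivity
    have := integral_comp_mul_left_Ioi (fun z : ℝ => h (z ^ (-α))) 0 hb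
    rw [mul_zero, inv_inv, smul_eq_mul] at this
    rw [← this]
    refine setIntegral_congr_fun measurableSet_Ioi fun z hz => ?_
    have hz : 0 < z := hz
    rw [Real.mul_rpow hb.le hz.le, ← Real.rpow_neg ha.le, ← Real.rpow_mul ha.le]
    congr 2
    rw [show -(1 / α) * -α = 1 by field_simp, Real.rpow_one]
  rw [hscale]
  refine Tendsto.congr' heq ?_
  refine tendsto_integral_filter_of_dominated_convergence
    (fun z : ℝ => min 1 (C * z ^ (-α))) ?_ ?_ (integrableOn_min_one_rpow hα hC.le) ?_
  · refine .of_forall fun T => Measurable.aestronglyMeasurable ?_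
    have h1 : Measurable fun n : ℕ => H T (p n) := measurable_from_nat
    exact h1.comp (Nat.measurable_floor.comp (measurable_const.mul measurable_id))
  · filter_upwards [eventually_gt_atTop 0] with T hT
    have hT' : (0 : ℝ) < T := by exact_mod_cast hT
    refine (ae_restrict_iff' measurableSet_Ioi).2 (.of_forall fun z hz => ?_)
    have hz : 0 < z := hz
    rw [Real.norm_of_nonneg (hH0 T _ (hp0 _) (hp1 _))]
    refine le_min (hH1 T _ (hp0 _) (hp1 _)) ((hHr T _ (hp0 _) (hp1 _)).trans ?_)
    set i := ⌊(T : ℝ) ^ (1 / α) * z⌋₊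
    -- The shift in `i + 1` gives a majorant independent of `T` and valid down to `z = 0`: no
    -- separate treatment of the first items is needed.
    have hi : (T : ℝ) ^ (1 / α) * z ≤ (i : ℝ) + 1 := (Nat.lt_floor_add_one _).le
    have h1 : ((i : ℝ) + 1) ^ (-α) ≤ ((T : ℝ) ^ (1 / α) * z) ^ (-α) :=
      Real.rpow_le_rpow_of_nonpos (by positivity) hi (by linarith)
    have h2 : ((T : ℝ) ^ (1 / α) * z) ^ (-α) = (T : ℝ)⁻¹ * z ^ (-α) := by
      rw [Real.mul_rpow (by positivity) hz.le, ← Real.rpow_mul hT'.le,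
        show 1 / α * -α = -1 by field_simp, Real.rpow_neg_one]
    calc (T : ℝ) * p i ≤ T * (C * ((T : ℝ)⁻¹ * z ^ (-α))) := by
          refine mul_le_mul_of_nonneg_left ((hpC i).trans ?_) hT'.le
          rw [← h2]
          exact mul_le_mul_of_nonneg_left h1 hC.le
      _ = C * z ^ (-α) := by field_simp
  · refine (ae_restrict_iff' measurableSet_Ioi).2 (.of_forall fun z hz => ?_)
    have hz : 0 < z := hz
    -- Pointwise limit: the item of index about `T ^ (1 / α) * z` has popularity about `a * z ^ (-α)
    -- / T`.
    refine hlim _ _ (by positivity) ?_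
    have hTb : Tendsto (fun T : ℕ => (T : ℝ) ^ (1 / α)) atTop atTop :=
      (tendsto_rpow_atTop (by positivity)).comp tendsto_natCast_atTop_atTop
    have hfl : Tendsto (fun T : ℕ => ⌊(T : ℝ) ^ (1 / α) * z⌋₊) atTop atTop :=
      tendsto_nat_floor_atTop.comp (hTb.atTop_mul_const hz)
    have hratio : Tendsto (fun T : ℕ => ((⌊(T : ℝ) ^ (1 / α) * z⌋₊ : ℝ) + 1) / (T : ℝ) ^ (1 / α))
        atTop (𝓝 z) := by
      have h1 := (tendsto_nat_floor_mul_div_atTop hz.le).comp hTb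
      have h2 := h1.add hTb.inv_tendsto_atTop
      rw [add_zero] at h2
      refine h2.congr fun T => ?_
      simp only [Function.comp, Pi.inv_apply]
      rw [add_div, one_div ((T : ℝ) ^ (1 / α)), mul_comm z]
    have hpa : Tendsto (fun i : ℕ => p i * ((i : ℝ) + 1) ^ α) atTop (𝓝 a) := by
      have h1 := (isEquivalent_iff_tendsto_one (.of_forall fun i : ℕ =>
        (by positivity : a / ((i : ℝ) + 1) ^ α ≠ 0))).1 hp
      have h2 := h1.mul_const a
      rw [one_mul] at h2
      refine h2.congr fun i => ?_
      have : (0 : ℝ) < ((i : ℝ) + 1) ^ α := by positivity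
      simp only [Pi.div_apply]
      field_simp
    have h3 := (hpa.comp hfl).mul (hratio.rpow_const (p := -α) (Or.inl hz.ne'))
    refine h3.congr' ?_
    filter_upwards [eventually_gt_atTop 0] with T hT
    have hT' : (0 : ℝ) < T := by exact_mod_cast hT
    simp only [Function.comp]
    set i := ⌊(T : ℝ) ^ (1 / α) * z⌋₊
    have hi : (0 : ℝ) < (i : ℝ) + 1 := by positivity
    rw [Real.div_rpow hi.le (by positivity), ← Real.rpow_mul hT'.le,
      show 1 / α * -α = -1 by field_simp, Real.rpow_neg_one, Real.rpow_neg hi.le]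
    have : (0 : ℝ) < ((i : ℝ) + 1) ^ α := by positivity
    field_simp

/-- The number of distinct items among the first requests grows like a power. -/
theorem tendsto_tsum_one_sub_exp {α : ℝ} (hα : 1 < α) {p : ℕ → ℝ} (hp0 : ∀ i, 0 ≤ p i)
    (hp1 : ∀ i, p i ≤ 1) {a : ℝ} (ha : 0 < a)
    (hp : p ~[atTop] fun i : ℕ => a / ((i : ℝ) + 1) ^ α) :
    Tendsto (fun T : ℕ => (T : ℝ) ^ (-(1 / α)) * ∑' i, (1 - Real.exp (-(T * p i)))) atTop
      (𝓝 (a ^ (1 / α) * ∫ z in Set.Ioi (0 : ℝ), (1 - Real.exp (-(z ^ (-α)))))) := by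
  refine tendsto_rpow_mul_tsum hα hp0 hp1 ha hp (H := fun T r => 1 - Real.exp (-(T * r)))
    (h := fun y => 1 - Real.exp (-y)) ?_ ?_ ?_ ?_
  · intro T r h0 _
    have : Real.exp (-(T * r)) ≤ 1 := Real.exp_le_one_iff.2 (by have := mul_nonneg T.cast_nonneg h0; linarith)
    linarith
  · intro T r _ _
    have := Real.exp_pos (-(T * r))
    linarith
  · intro T r _ _
    have := Real.add_one_le_exp (-(T * r))
    linarith
  · intro y r _ h
    exact tendsto_const_nhds.sub ((Real.continuous_exp.tendsto _).comp h.neg)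

theorem one_sub_pow_le_exp {r : ℝ} (h1 : r ≤ 1) (T : ℕ) :
    (1 - r) ^ T ≤ Real.exp (-(T * r)) := by
  calc (1 - r) ^ T ≤ Real.exp (-r) ^ T :=
        pow_le_pow_left₀ (by linarith) (by have := Real.add_one_le_exp (-r); linarith) T
    _ = Real.exp (-(T * r)) := by rw [← Real.exp_nat_mul]; congr 1; ring

theorem tendsto_one_sub_pow {r : ℕ → ℝ} {y : ℝ}
    (h : Tendsto (fun T : ℕ => T * r T) atTop (𝓝 y)) :
    Tendsto (fun T : ℕ => (1 - r T) ^ T) atTop (𝓝 (Real.exp (-y))) := by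
  have := Real.tendsto_one_add_pow_exp_of_tendsto (g := fun T => -r T) (t := -y)
    (by simpa using h.neg)
  simpa [sub_eq_add_neg] using this

theorem tendsto_tsum_mul_one_sub_pow {α : ℝ} (hα : 1 < α) {p : ℕ → ℝ} (hp0 : ∀ i, 0 ≤ p i)
    (hp1 : ∀ i, p i ≤ 1) {a : ℝ} (ha : 0 < a)
    (hp : p ~[atTop] fun i : ℕ => a / ((i : ℝ) + 1) ^ α) :
    Tendsto (fun T : ℕ => (T : ℝ) ^ (1 - 1 / α) * ∑' i, p i * (1 - p i) ^ T) atTop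
      (𝓝 (a ^ (1 / α) * ∫ z in Set.Ioi (0 : ℝ), z ^ (-α) * Real.exp (-(z ^ (-α))))) := by
  have key := tendsto_rpow_mul_tsum hα hp0 hp1 ha hp (H := fun T r => T * r * (1 - r) ^ T)
    (h := fun y => y * Real.exp (-y)) ?_ ?_ ?_ ?_
  · refine key.congr' ?_
    filter_upwards [eventually_gt_atTop 0] with T hT
    have hT' : (0 : ℝ) < T := by exact_mod_cast hT
    simp only [mul_assoc]
    rw [tsum_mul_left, ← mul_assoc, sub_eq_neg_add, Real.rpow_add hT', Real.rpow_one]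
  · intro T r h0 h1
    exact mul_nonneg (mul_nonneg T.cast_nonneg h0) (pow_nonneg (by linarith) _)
  · intro T r h0 h1
    have h2 := mul_le_mul_of_nonneg_left (one_sub_pow_le_exp h1 T) (mul_nonneg T.cast_nonneg h0)
    refine h2.trans ?_
    rw [Real.exp_neg, ← div_eq_mul_inv, div_le_one (Real.exp_pos _)]
    have := Real.add_one_le_exp (T * r)
    linarith
  · intro T r h0 h1
    exact mul_le_of_le_one_right (mul_nonneg T.cast_nonneg h0)
      (pow_le_one₀ (by linarith) (by linarith))
  · intro y r _ h
    exact h.mul (tendsto_one_sub_pow h)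

theorem integral_one_sub_exp_pos {α : ℝ} (hα : 1 < α) :
    0 < ∫ z in Set.Ioi (0 : ℝ), (1 - Real.exp (-(z ^ (-α)))) := by
  have hpos : ∀ z ∈ Set.Ioi (0 : ℝ), 0 < 1 - Real.exp (-(z ^ (-α))) := by
    intro z hz
    have hz : (0 : ℝ) < z := hz
    have : Real.exp (-(z ^ (-α))) < 1 := by
      rw [Real.exp_lt_one_iff, neg_lt_zero]
      positivity
    linarith
  have hint : IntegrableOn (fun z : ℝ => 1 - Real.exp (-(z ^ (-α)))) (Set.Ioi 0) := by
    refine Integrable.mono' (integrableOn_min_one_rpow hα zero_le_one)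
      (Measurable.aestronglyMeasurable (by fun_prop)) ?_
    refine (ae_restrict_iff' measurableSet_Ioi).2 (.of_forall fun z hz => ?_)
    rw [Real.norm_of_nonneg (hpos z hz).le, one_mul]
    have h1 := Real.exp_pos (-(z ^ (-α)))
    have h2 := Real.add_one_le_exp (-(z ^ (-α)))
    exact le_min (by linarith) (by linarith)
  rw [setIntegral_pos_iff_support_of_nonneg_ae
    ((ae_restrict_iff' measurableSet_Ioi).2 (.of_forall fun z hz => (hpos z hz).le)) hint]
  have : Set.Ioi (0 : ℝ) ⊆ Function.support (fun z : ℝ => 1 - Real.exp (-(z ^ (-α)))) :=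
    fun z hz => (hpos z hz).ne'
  rw [Set.inter_eq_right.2 this]
  simp

theorem integral_mul_exp_pos {α : ℝ} (hα : 1 < α) :
    0 < ∫ z in Set.Ioi (0 : ℝ), z ^ (-α) * Real.exp (-(z ^ (-α))) := by
  have hpos : ∀ z ∈ Set.Ioi (0 : ℝ), 0 < z ^ (-α) * Real.exp (-(z ^ (-α))) := by
    intro z hz
    have hz : (0 : ℝ) < z := hz
    positivity
  have hint : IntegrableOn (fun z : ℝ => z ^ (-α) * Real.exp (-(z ^ (-α)))) (Set.Ioi 0) := by
    refine Integrable.mono' (integrableOn_min_one_rpow hα zero_le_one)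
      (Measurable.aestronglyMeasurable (by fun_prop)) ?_
    refine (ae_restrict_iff' measurableSet_Ioi).2 (.of_forall fun z hz => ?_)
    have hz : (0 : ℝ) < z := hz
    have hy : 0 < z ^ (-α) := by positivity
    rw [Real.norm_of_nonneg (hpos z hz).le, one_mul]
    refine le_min ?_ (mul_le_of_le_one_right hy.le (Real.exp_le_one_iff.2 (by linarith)))
    rw [Real.exp_neg, ← div_eq_mul_inv, div_le_one (Real.exp_pos _)]
    have := Real.add_one_le_exp (z ^ (-α))
    linarith
  rw [setIntegral_pos_iff_support_of_nonneg_ae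
    ((ae_restrict_iff' measurableSet_Ioi).2 (.of_forall fun z hz => (hpos z hz).le)) hint]
  have : Set.Ioi (0 : ℝ) ⊆
      Function.support (fun z : ℝ => z ^ (-α) * Real.exp (-(z ^ (-α)))) :=
    fun z hz => (hpos z hz).ne'
  rw [Set.inter_eq_right.2 this]
  simp

/-! ### Recent items, void probabilities and Poissonization. -/

namespace RequestModel

variable {Ω : Type*} [MeasurableSpace Ω] {P : Measure Ω} {D : Type*} [MeasurableSpace D] {M : ℕ}

/-- The probability that a request asks for the item `d`. -/
noncomputable def pop (X : RequestModel P D M) (d : D) : ℝ := P.real {ω | X.R 0 ω = d}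

/-- The event that none of the last `T` requests before request `0` asks for an item of `A`. -/
def noHit (X : RequestModel P D M) (A : Set D) (T : ℕ) : Set Ω :=
  {ω | ∀ m ∈ Finset.Icc (-(T : ℤ)) (-1), X.R m ω ∉ A}

open Classical in
/-- The items that the last `T` requests before request `0` ask for. -/
noncomputable def recent (X : RequestModel P D M) (T : ℕ) (ω : Ω) : Finset D :=
  (Finset.Icc (-(T : ℤ)) (-1)).image fun m => X.R m ω

theorem mem_recent {X : RequestModel P D M} {T : ℕ} {ω : Ω} {d : D} :
    d ∈ X.recent T ω ↔ ∃ m ∈ Finset.Icc (-(T : ℤ)) (-1), X.R m ω = d := by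
  classical
  simp [recent]

theorem mem_noHit_singleton {X : RequestModel P D M} {T : ℕ} {ω : Ω} {d : D} :
    ω ∈ X.noHit {d} T ↔ d ∉ X.recent T ω := by
  rw [mem_recent]
  simp [noHit]

theorem pop_nonneg (X : RequestModel P D M) (d : D) : 0 ≤ X.pop d := measureReal_nonneg

theorem pop_le_one [IsProbabilityMeasure P] (X : RequestModel P D M) (d : D) : X.pop d ≤ 1 := measureReal_le_one

theorem measureReal_R_mem_finset [MeasurableSingletonClass D] [IsProbabilityMeasure P]
    (X : RequestModel P D M) (A : Finset D) :
    P.real {ω | X.R 0 ω ∈ (A : Set D)} = ∑ d ∈ A, X.pop d := by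
  have : {ω | X.R 0 ω ∈ (A : Set D)} = ⋃ d ∈ A, {ω | X.R 0 ω = d} := by
    ext ω
    simp
  rw [this, measureReal_biUnion_finset]
  · rfl
  · intro d _ e _ hde
    exact Set.disjoint_left.2 fun ω h1 h2 => hde (h1.symm.trans h2)
  · exact fun d _ => X.measurable_R 0 (measurableSet_singleton d)

section Void

variable [MeasurableSingletonClass D] [Countable D]

theorem measurableSet_noHit (X : RequestModel P D M) (A : Set D) (T : ℕ) :
    MeasurableSet (X.noHit A T) := by
  have : X.noHit A T = ⋂ m ∈ Finset.Icc (-(T : ℤ)) (-1), X.R m ⁻¹' Aᶜ := by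
    ext ω
    simp [noHit]
  rw [this]
  exact Finset.measurableSet_biInter _ fun m _ => X.measurable_R m (Set.to_countable _).measurableSet

theorem measurableSet_recent (X : RequestModel P D M) (T : ℕ) (p : Finset D → Prop) :
    MeasurableSet {ω | p (X.recent T ω)} := by
  have : {ω | p (X.recent T ω)} = ⋃ B : {B : Finset D // p B}, {ω | X.recent T ω = B.1} := by
    ext ω
    simp
  rw [this]
  refine MeasurableSet.iUnion fun B => ?_
  have : {ω | X.recent T ω = B.1} =
      (⋂ d ∈ B.1, (X.noHit {d} T)ᶜ) ∩ ⋂ d ∈ (B.1 : Set D)ᶜ, X.noHit {d} T := by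
    ext ω
    simp only [Set.mem_ofPred_eq, Set.mem_inter_iff, Set.mem_iInter, Set.mem_compl_iff,
      mem_noHit_singleton, not_not, Finset.mem_coe, Finset.ext_iff]
    constructor
    · exact fun h => ⟨fun d hd => (h d).2 hd, fun d hd hd' => hd ((h d).1 hd')⟩
    · exact fun h d => ⟨fun hd => by_contra fun hn => h.2 d hn hd, h.1 d⟩
  rw [this]
  exact (Finset.measurableSet_biInter _ fun d _ => (X.measurableSet_noHit _ _).compl).inter
    (MeasurableSet.biInter (Set.to_countable _) fun d _ => X.measurableSet_noHit _ _)

variable [IsProbabilityMeasure P]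

/-- Independence of request `0` and the `T` requests before it, which are identically distributed.
This is the only place where the law of several requests enters. -/
theorem measureReal_inter_noHit (X : RequestModel P D M) (U : Set (Fin M × D)) (A : Set D) (T : ℕ) :
    P.real ({ω | (X.I 0 ω, X.R 0 ω) ∈ U} ∩ X.noHit A T) =
      P.real {ω | (X.I 0 ω, X.R 0 ω) ∈ U} * (1 - P.real {ω | X.R 0 ω ∈ A}) ^ T := by
  classical
  let sets : ℤ → Set (Fin M × D) := fun n => if n = 0 then U else Prod.snd ⁻¹' Aᶜ
  have hmeas : ∀ V : Set (Fin M × D), MeasurableSet V := fun V => (Set.to_countable V).measurableSet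
  have h := X.indep.measure_inter_preimage_eq_mul (insert 0 (Finset.Icc (-(T : ℤ)) (-1)))
    (sets := sets) fun n _ => hmeas _
  have h0 : (0 : ℤ) ∉ Finset.Icc (-(T : ℤ)) (-1) := by simp
  rw [Finset.prod_insert h0, Finset.set_biInter_insert] at h
  have hne : ∀ m ∈ Finset.Icc (-(T : ℤ)) (-1), sets m = Prod.snd ⁻¹' Aᶜ := by
    intro m hm
    have : m ≠ 0 := fun h => h0 (h ▸ hm)
    simp [sets, this]
  have hprod : ∏ m ∈ Finset.Icc (-(T : ℤ)) (-1), P ((fun ω => (X.I m ω, X.R m ω)) ⁻¹' sets m) =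
      P {ω | X.R 0 ω ∈ Aᶜ} ^ T := by
    rw [Finset.prod_congr rfl (g := fun _ => P {ω | X.R 0 ω ∈ Aᶜ}) fun m hm => ?_]
    · rw [Finset.prod_const]
      simp
    · rw [hne m hm, (X.identDistrib m).measure_mem_eq (hmeas _)]
      rfl
  have hinter : (⋂ m ∈ Finset.Icc (-(T : ℤ)) (-1), (fun ω => (X.I m ω, X.R m ω)) ⁻¹' sets m) =
      X.noHit A T := by
    ext ω
    simp only [Set.mem_iInter, noHit, Set.mem_ofPred_eq, Set.mem_preimage]
    refine forall₂_congr fun m hm => ?_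
    rw [hne m hm]
    rfl
  rw [hprod, hinter] at h
  have hs0 : (fun ω => (X.I 0 ω, X.R 0 ω)) ⁻¹' sets 0 = {ω | (X.I 0 ω, X.R 0 ω) ∈ U} := by
    simp [sets]; rfl
  rw [hs0] at h
  have hc : P.real {ω | X.R 0 ω ∈ Aᶜ} = 1 - P.real {ω | X.R 0 ω ∈ A} :=
    probReal_compl_eq_one_sub (X.measurable_R 0 (Set.to_countable A).measurableSet)
  rw [← hc, measureReal_def, h, ENNReal.toReal_mul, ENNReal.toReal_pow]
  rfl

theorem measureReal_noHit (X : RequestModel P D M) (A : Set D) (T : ℕ) :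
    P.real (X.noHit A T) = (1 - P.real {ω | X.R 0 ω ∈ A}) ^ T := by
  have := X.measureReal_inter_noHit Set.univ A T
  simpa using this

theorem integrable_recent (X : RequestModel P D M) (T : ℕ) (B : Finset D) (f : Finset D → ℝ)
    [DecidableEq D] : Integrable (fun ω => f (B ∩ X.recent T ω)) P := by
  obtain ⟨C, hC⟩ : ∃ C, ∀ A ∈ B.powerset, ‖f A‖ ≤ C :=
    ⟨∑ A ∈ B.powerset, ‖f A‖, fun A hA =>
      Finset.single_le_sum (f := fun A => ‖f A‖) (fun _ _ => norm_nonneg _) hA⟩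
  refine Integrable.of_bound (C := C) (Measurable.aestronglyMeasurable ?_)
    (.of_forall fun ω => hC _ (Finset.mem_powerset.2 Finset.inter_subset_left))
  intro s _
  exact X.measurableSet_recent T fun A => f (B ∩ A) ∈ s

/-- Write `w ^ card` as the product over `d ∈ B` of `(1 - w) * 1{d not recent} + w` and expand over
subsets `A` of `B`; what remains are the probabilities that `A` is not hit, which are explicit
powers. -/
theorem integral_pow_card_recent [DecidableEq D] (X : RequestModel P D M) (B : Finset D) (w : ℝ)
    (T : ℕ) :
    ∫ ω, w ^ (B ∩ X.recent T ω).card ∂P =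
      ∑ A ∈ B.powerset, (1 - w) ^ A.card * w ^ (B \ A).card * (1 - ∑ d ∈ A, X.pop d) ^ T := by
  classical
  have hpt : ∀ ω, w ^ (B ∩ X.recent T ω).card =
      ∑ A ∈ B.powerset, (1 - w) ^ A.card * w ^ (B \ A).card *
        (X.noHit (A : Set D) T).indicator (fun _ => (1 : ℝ)) ω := by
    intro ω
    have h1 : w ^ (B ∩ X.recent T ω).card =
        ∏ d ∈ B, ((if d ∈ X.recent T ω then 0 else 1 - w) + w) := by
      rw [← Finset.filter_mem_eq_inter, ← Finset.prod_const, Finset.prod_filter]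
      refine Finset.prod_congr rfl fun d _ => ?_
      split_ifs <;> simp
    rw [h1, Finset.prod_add]
    refine Finset.sum_congr rfl fun A _ => ?_
    rw [Finset.prod_const, mul_right_comm]
    congr 1
    by_cases hA : ω ∈ X.noHit (A : Set D) T
    · rw [Set.indicator_of_mem hA, mul_one, ← Finset.prod_const]
      refine Finset.prod_congr rfl fun d hd => if_neg fun hr => ?_
      obtain ⟨m, hm, rfl⟩ := mem_recent.1 hr
      exact hA m hm hd
    · rw [Set.indicator_of_notMem hA, mul_zero]
      simp only [noHit, Set.mem_ofPred_eq, not_forall, not_not] at hA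
      obtain ⟨m, hm, hmA⟩ := hA
      exact Finset.prod_eq_zero hmA (if_pos (mem_recent.2 ⟨m, hm, rfl⟩))
  simp_rw [hpt]
  have hind : ∀ A : Finset D,
      Integrable ((X.noHit (A : Set D) T).indicator fun _ => (1 : ℝ)) P := fun A =>
    (integrable_const 1).indicator (X.measurableSet_noHit _ _)
  rw [integral_finsetSum _ fun A _ => (hind A).const_mul _]
  refine Finset.sum_congr rfl fun A _ => ?_
  rw [integral_const_mul, integral_indicator_const _ (X.measurableSet_noHit _ _), measureReal_noHit,
    measureReal_R_mem_finset, smul_eq_mul, mul_one]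

/-- Poissonization: the Poisson mixture of the generating functions factorizes. -/
theorem hasSum_poisson_integral_pow_card [DecidableEq D] (X : RequestModel P D M) (B : Finset D)
    (w l : ℝ) :
    HasSum (fun n : ℕ => l ^ n / n.factorial * ∫ ω, w ^ (B ∩ X.recent n ω).card ∂P)
      (Real.exp l * ∏ d ∈ B, (1 + (w - 1) * (1 - Real.exp (-(l * X.pop d))))) := by
  have hexp : ∀ A ∈ B.powerset, HasSum (fun n : ℕ => l ^ n / n.factorial *
      ((1 - w) ^ A.card * w ^ (B \ A).card * (1 - ∑ d ∈ A, X.pop d) ^ n))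
      (Real.exp l * ((∏ d ∈ A, (1 - w) * Real.exp (-(l * X.pop d))) * ∏ d ∈ B \ A, w)) := by
    intro A _
    have h0 : ∀ x : ℝ, HasSum (fun n : ℕ => x ^ n / n.factorial) (Real.exp x) := fun x => by
      rw [Real.exp_eq_exp_ℝ]
      exact NormedSpace.expSeries_div_hasSum_exp x
    have h := (h0 (l * (1 - ∑ d ∈ A, X.pop d))).mul_left ((1 - w) ^ A.card * w ^ (B \ A).card)
    have hval : Real.exp l * ((∏ d ∈ A, (1 - w) * Real.exp (-(l * X.pop d))) * ∏ d ∈ B \ A, w) =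
        (1 - w) ^ A.card * w ^ (B \ A).card * Real.exp (l * (1 - ∑ d ∈ A, X.pop d)) := by
      rw [Finset.prod_mul_distrib, Finset.prod_const, Finset.prod_const, ← Real.exp_sum,
        mul_sub, mul_one, sub_eq_add_neg l, Real.exp_add, Finset.sum_neg_distrib, Finset.mul_sum]
      ring
    have hterm : ∀ n : ℕ, l ^ n / n.factorial *
        ((1 - w) ^ A.card * w ^ (B \ A).card * (1 - ∑ d ∈ A, X.pop d) ^ n) =
        (1 - w) ^ A.card * w ^ (B \ A).card *
          ((l * (1 - ∑ d ∈ A, X.pop d)) ^ n / n.factorial) := fun n => by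
      rw [mul_pow]
      ring
    simpa only [hval, hterm] using h
  have h := hasSum_sum hexp
  convert h using 1
  · ext n
    rw [integral_pow_card_recent, Finset.mul_sum]
  · rw [← Finset.mul_sum, ← Finset.prod_add]
    congr 1
    exact Finset.prod_congr rfl fun d _ => by ring

/-- The loss in passing from `T` requests to a Poisson number of requests of mean `T`. -/
noncomputable def _root_.poissonLoss (T : ℕ) : ℝ := T.factorial * Real.exp T / (T : ℝ) ^ T

theorem integral_pow_card_recent_le [DecidableEq D] (X : RequestModel P D M) (B : Finset D) {w : ℝ}
    (hw : 0 < w) {T : ℕ} (hT : 0 < T) :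
    ∫ ω, w ^ (B ∩ X.recent T ω).card ∂P ≤
      poissonLoss T * Real.exp ((w - 1) * ∑ d ∈ B, (1 - Real.exp (-(T * X.pop d)))) := by
  have h0 : ∀ n : ℕ, 0 ≤ ∫ ω, w ^ (B ∩ X.recent n ω).card ∂P := fun n =>
    integral_nonneg fun ω => by positivity
  -- All terms of the Poisson mixture are nonnegative, so the single term `n = T` of the mixture
  -- with mean `T` is at most the whole sum.
  have h1 := le_hasSum (X.hasSum_poisson_integral_pow_card B w T) T fun n _ =>
    mul_nonneg (by positivity) (h0 n)
  have h2 : ∏ d ∈ B, (1 + (w - 1) * (1 - Real.exp (-(T * X.pop d)))) ≤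
      Real.exp ((w - 1) * ∑ d ∈ B, (1 - Real.exp (-(T * X.pop d)))) := by
    rw [Finset.mul_sum, Real.exp_sum]
    refine Finset.prod_le_prod (fun d _ => ?_) fun d _ => ?_
    · have h3 := Real.exp_pos (-(T * X.pop d))
      have h4 : Real.exp (-(T * X.pop d)) ≤ 1 := Real.exp_le_one_iff.2 (by
        have := mul_nonneg T.cast_nonneg (X.pop_nonneg d); linarith)
      nlinarith
    · rw [add_comm]
      exact Real.add_one_le_exp _
  have hT' : (0 : ℝ) < T := by exact_mod_cast hT
  have h5 := h1.trans (mul_le_mul_of_nonneg_left h2 (Real.exp_pos _).le)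
  have hpos : (0 : ℝ) < (T : ℝ) ^ T / T.factorial := by positivity
  rw [mul_comm, ← le_div_iff₀ hpos] at h5
  refine h5.trans (le_of_eq ?_)
  rw [poissonLoss]
  field_simp

/-- Chernoff's bound for the number of items of `B` among the last `T` requests. -/
theorem measureReal_rpow_le_pow_card_recent [DecidableEq D] (X : RequestModel P D M) (B : Finset D)
    {w : ℝ} (hw : 0 < w) {T : ℕ} (hT : 0 < T) (y : ℝ) :
    P.real {ω | w ^ y ≤ w ^ ((B ∩ X.recent T ω).card : ℝ)} ≤
      poissonLoss T * w ^ (-y) *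
        Real.exp ((w - 1) * ∑ d ∈ B, (1 - Real.exp (-(T * X.pop d)))) := by
  -- Markov's inequality. The event is left in the form `w ^ y ≤ w ^ card` so that it serves the
  -- upper tail for `w > 1` and the lower tail for `w < 1`.
  have h := mul_meas_ge_le_integral_of_nonneg (μ := P)
    (f := fun ω => w ^ (B ∩ X.recent T ω).card) (.of_forall fun ω => by positivity)
    (X.integrable_recent T B fun A => w ^ A.card) (w ^ y)
  have h2 := h.trans (X.integral_pow_card_recent_le B hw hT)
  rw [mul_comm, ← le_div_iff₀ (by positivity)] at h2
  simp only [Real.rpow_natCast]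
  refine h2.trans (le_of_eq ?_)
  rw [Real.rpow_neg hw.le]
  field_simp

end Void
-- From search costs to counts of recent items.
/-- The items in the lists of the flows `G`. -/
def itemsOf (X : RequestModel P D M) (G : Finset (Fin M)) : Set D :=
  {d | ∃ g ∈ G, ∃ i, X.item g i = d}

open Classical in
/-- The number of distinct items of the flows `G` among the last `T` requests before request `0`. -/
noncomputable def recentCount (X : RequestModel P D M) (G : Finset (Fin M)) (T : ℕ) (ω : Ω) : ℕ :=
  ((X.recent T ω).filter (· ∈ X.itemsOf G)).card

/-- The mean of the number of distinct items of the flows `G` among `N` requests, `N` being Poisson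
of mean `T`. -/
noncomputable def poissonMean (X : RequestModel P D M) (G : Finset (Fin M)) (T : ℕ) : ℝ :=
  ∑ g ∈ G, ∑' i, (1 - Real.exp (-(T * X.pop (X.item g i))))

/-- The probability that none of the last `T` requests asks for the item that request `0`, coming
from flow `k`, asks for. -/
noncomputable def freshProb (X : RequestModel P D M) (k : Fin M) (T : ℕ) : ℝ :=
  (P[|{ω | X.I 0 ω = k}]).real {ω | X.R 0 ω ∉ X.recent T ω}

theorem NonOverlapping.item_inj {X : RequestModel P D M} (hX : X.NonOverlapping) {k g : Fin M}
    {i j : ℕ} (h : X.item k i = X.item g j) : k = g ∧ i = j := by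
  have hkg : k = g := by_contra fun hn => hX k g hn i j h
  subst hkg
  exact ⟨rfl, X.item_injective k h⟩

theorem NonOverlapping.mem_itemsOf {X : RequestModel P D M} (hX : X.NonOverlapping)
    {G : Finset (Fin M)} {m : ℤ} {ω : Ω} (h : X.R m ω ∈ Set.range (X.item (X.I m ω))) :
    X.R m ω ∈ X.itemsOf G ↔ X.I m ω ∈ G := by
  obtain ⟨i, hi⟩ := h
  constructor
  · rintro ⟨g, hg, j, hj⟩
    rwa [(hX.item_inj (hi.trans hj.symm)).1]
  · exact fun hG => ⟨_, hG, i, hi⟩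

/-- The search cost is at least the size of the recent items if the requested item is not recent,
and at most that size otherwise. -/
theorem searchCost_bounds {X : RequestModel P D M} (hX : X.NonOverlapping) {s : ℝ}
    (hs : ∀ k i, X.size (X.item k i) = s) {G : Finset (Fin M)} {S : Set ℤ} {ω : Ω}
    (hR : ∀ m, X.R m ω ∈ Set.range (X.item (X.I m ω))) (hS : ∀ m, m ∈ S ↔ X.I m ω ∈ G)
    (h0 : X.I 0 ω ∈ G) (T : ℕ) :
    (X.R 0 ω ∉ X.recent T ω → ENNReal.ofReal s * X.recentCount G T ω ≤ X.searchCost S 0 ω) ∧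
    (X.R 0 ω ∈ X.recent T ω → X.searchCost S 0 ω ≤ ENNReal.ofReal s * X.recentCount G T ω) := by
  classical
  set W := (X.recent T ω).filter (· ∈ X.itemsOf G) with hW
  have hsum : ∑' d : (W : Set D), ENNReal.ofReal (X.size d) =
      ENNReal.ofReal s * X.recentCount G T ω := by
    rw [Finset.tsum_subtype' W fun d => ENNReal.ofReal (X.size d),
      Finset.sum_congr rfl (g := fun _ => ENNReal.ofReal s) fun d hd => ?_]
    · rw [Finset.sum_const, nsmul_eq_mul, mul_comm, recentCount]
    · obtain ⟨g, -, i, rfl⟩ := (Finset.mem_filter.1 hd).2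
      rw [hs]
  rw [← hsum, searchCost]
  constructor
  · intro hfresh
    refine ENNReal.tsum_mono_subtype (fun d => ENNReal.ofReal (X.size d)) fun d hd => ?_
    obtain ⟨hd1, hd2⟩ := Finset.mem_filter.1 (Finset.mem_coe.1 hd)
    obtain ⟨m, hm, rfl⟩ := mem_recent.1 hd1
    rw [Finset.mem_Icc] at hm
    refine ⟨m, (hS m).2 ((hX.mem_itemsOf (hR m)).1 hd2), by omega, rfl, fun j _ hj hj0 he => ?_⟩
    exact hfresh (mem_recent.2 ⟨j, Finset.mem_Icc.2 (by omega), he⟩)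
  · intro hrec
    refine ENNReal.tsum_mono_subtype (fun d => ENNReal.ofReal (X.size d)) fun d hd => ?_
    obtain ⟨m, hmS, hm0, rfl, hlast⟩ := hd
    obtain ⟨j, hj, hj0⟩ := mem_recent.1 hrec
    rw [Finset.mem_Icc] at hj
    -- A recent request for the same item comes from the same flow because the lists are disjoint,
    -- so it is seen by this cache.
    have hjS : j ∈ S := by
      rw [hS, ← hX.mem_itemsOf (hR j), hj0, hX.mem_itemsOf (hR 0)]
      exact h0
    have hmj : j < m := by
      by_contra hle
      exact hlast j hjS (by omega) (by omega) hj0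
    refine Finset.mem_coe.2 (Finset.mem_filter.2 ⟨mem_recent.2 ⟨m, Finset.mem_Icc.2 (by omega), rfl⟩,
      (hX.mem_itemsOf (hR m)).2 ((hS m).1 hmS)⟩)

theorem ν_pos [IsFiniteMeasure P] (X : RequestModel P D M) (k : Fin M) : 0 < X.ν k :=
  ENNReal.toReal_pos (X.flow_pos k) (measure_ne_top _ _)

theorem measurableSet_flow (X : RequestModel P D M) (k : Fin M) :
    MeasurableSet {ω | X.I 0 ω = k} := X.measurable_I 0 (measurableSet_singleton k)

theorem cond_real_eq [IsFiniteMeasure P] (X : RequestModel P D M) (k : Fin M) (t : Set Ω) :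
    (P[|{ω | X.I 0 ω = k}]).real t = (X.ν k)⁻¹ * P.real ({ω | X.I 0 ω = k} ∩ t) := by
  rw [measureReal_def, cond_apply (X.measurableSet_flow k), ENNReal.toReal_mul, ENNReal.toReal_inv]
  rfl

theorem cond_real_le [IsFiniteMeasure P] (X : RequestModel P D M) (k : Fin M) (t : Set Ω) :
    (P[|{ω | X.I 0 ω = k}]).real t ≤ (X.ν k)⁻¹ * P.real t := by
  rw [cond_real_eq]
  exact mul_le_mul_of_nonneg_left (measureReal_mono Set.inter_subset_right)
    (inv_nonneg.2 (X.ν_pos k).le)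

theorem overallSepMiss_eq_sum [IsFiniteMeasure P] (X : RequestModel P D M) (u : Fin M → ℝ) (x : ℝ) :
    X.overallSepMiss u x = ∑ k, X.ν k * X.sepMiss k (u k * x) := by
  -- Restricting `P` to the miss event and splitting the whole space by flows avoids proving that
  -- the miss event is measurable.
  have h := measureReal_restrict_apply_univ (μ := P)
    {ω | ENNReal.ofReal (u (X.I 0 ω) * x) < X.sepCost 0 ω}
  have hU : (Set.univ : Set Ω) = ⋃ k ∈ (Finset.univ : Finset (Fin M)), {ω | X.I 0 ω = k} := by
    ext ω
    simp
  rw [overallSepMiss, ← h, hU, measureReal_biUnion_finset]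
  · refine Finset.sum_congr rfl fun k _ => ?_
    rw [measureReal_restrict_apply (X.measurableSet_flow k), sepMiss, cond_real_eq, ← mul_assoc,
      mul_inv_cancel₀ (X.ν_pos k).ne', one_mul]
    congr 1
    ext ω
    simp only [Set.mem_inter_iff, Set.mem_ofPred_eq]
    exact and_congr_right fun hk => by rw [hk]
  · intro k _ g _ hkg
    exact Set.disjoint_left.2 fun ω h1 h2 => hkg (h1.symm.trans h2)
  · exact fun k _ => X.measurableSet_flow k

theorem sepMiss_antitone [IsProbabilityMeasure P] (X : RequestModel P D M) (k : Fin M) :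
    Antitone (X.sepMiss k) := by
  have := cond_isProbabilityMeasure (X.flow_pos k)
  intro x y hxy
  refine measureReal_mono fun ω hω => ?_
  exact lt_of_le_of_lt (ENNReal.ofReal_le_ofReal hxy) hω

/-- A cost that depends on the past like the search costs do. -/
def CostBounds (X : RequestModel P D M) (s : ℝ) (k : Fin M) (G : Finset (Fin M))
    (cost : Ω → ℝ≥0∞) : Prop :=
  ∀ᵐ ω ∂P, X.I 0 ω = k → ∀ T : ℕ,
    (X.R 0 ω ∉ X.recent T ω → ENNReal.ofReal s * X.recentCount G T ω ≤ cost ω) ∧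
    (X.R 0 ω ∈ X.recent T ω → cost ω ≤ ENNReal.ofReal s * X.recentCount G T ω)

theorem costBounds_poolCost {X : RequestModel P D M} (hX : X.NonOverlapping) {s : ℝ}
    (hs : ∀ k i, X.size (X.item k i) = s) (k : Fin M) :
    X.CostBounds s k Finset.univ (X.poolCost 0) := by
  filter_upwards [ae_all_iff.2 X.request_mem] with ω hR _ T
  exact searchCost_bounds hX hs hR (by simp) (by simp) T

theorem costBounds_sepCost {X : RequestModel P D M} (hX : X.NonOverlapping) {s : ℝ}
    (hs : ∀ k i, X.size (X.item k i) = s) (k : Fin M) :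
    X.CostBounds s k {k} (X.sepCost 0) := by
  filter_upwards [ae_all_iff.2 X.request_mem] with ω hR hk T
  exact searchCost_bounds hX hs hR (by simp [hk]) (by simp [hk]) T

theorem ofReal_lt_ofReal_mul_natCast {s x : ℝ} (hs : 0 < s) (hx : 0 ≤ x) (n : ℕ) :
    ENNReal.ofReal x < ENNReal.ofReal s * n ↔ x / s < n := by
  rw [← ENNReal.ofReal_natCast, ← ENNReal.ofReal_mul hs.le, ENNReal.ofReal_lt_ofReal_iff_of_nonneg hx,
    div_lt_iff₀' hs]

/-- If the requested item is recent, a miss can only come from an unusually large number of distinct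
recent items. `CostBounds.le_miss` is the counterpart: if the item is not recent, a hit needs an
unusually small number. -/
theorem CostBounds.miss_le [IsProbabilityMeasure P] {X : RequestModel P D M} {s : ℝ} (hs : 0 < s)
    {k : Fin M} {G : Finset (Fin M)} {cost : Ω → ℝ≥0∞} (h : X.CostBounds s k G cost) {x : ℝ}
    (hx : 0 ≤ x) (T : ℕ) :
    (P[|{ω | X.I 0 ω = k}]).real {ω | ENNReal.ofReal x < cost ω} ≤
      X.freshProb k T + (X.ν k)⁻¹ * P.real {ω | x / s < X.recentCount G T ω} := by
  have := cond_isProbabilityMeasure (X.flow_pos k)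
  have h1 : {ω | ENNReal.ofReal x < cost ω} ≤ᵐ[P[|{ω | X.I 0 ω = k}]]
      ({ω | X.R 0 ω ∉ X.recent T ω} ∪ {ω | x / s < X.recentCount G T ω} : Set Ω) := by
    filter_upwards [cond_absolutelyContinuous.ae_le h, ae_cond_mem (X.measurableSet_flow k)]
      with ω hω hk hmiss
    by_cases hr : X.R 0 ω ∈ X.recent T ω
    · exact Or.inr ((ofReal_lt_ofReal_mul_natCast hs hx _).1
        (lt_of_lt_of_le hmiss ((hω hk T).2 hr)))
    · exact Or.inl hr
  calc _ ≤ (P[|{ω | X.I 0 ω = k}]).real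
        ({ω | X.R 0 ω ∉ X.recent T ω} ∪ {ω | x / s < X.recentCount G T ω}) :=
        ENNReal.toReal_mono (measure_ne_top _ _) (measure_mono_ae h1)
    _ ≤ _ := (measureReal_union_le _ _).trans (add_le_add le_rfl (X.cond_real_le k _))

theorem CostBounds.le_miss [IsProbabilityMeasure P] {X : RequestModel P D M} {s : ℝ} (hs : 0 < s)
    {k : Fin M} {G : Finset (Fin M)} {cost : Ω → ℝ≥0∞} (h : X.CostBounds s k G cost) {x : ℝ}
    (hx : 0 ≤ x) (T : ℕ) :
    X.freshProb k T ≤ (P[|{ω | X.I 0 ω = k}]).real {ω | ENNReal.ofReal x < cost ω} +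
      (X.ν k)⁻¹ * P.real {ω | (X.recentCount G T ω : ℝ) ≤ x / s} := by
  have := cond_isProbabilityMeasure (X.flow_pos k)
  have h1 : {ω | X.R 0 ω ∉ X.recent T ω} ≤ᵐ[P[|{ω | X.I 0 ω = k}]]
      ({ω | ENNReal.ofReal x < cost ω} ∪ {ω | (X.recentCount G T ω : ℝ) ≤ x / s} : Set Ω) := by
    filter_upwards [cond_absolutelyContinuous.ae_le h, ae_cond_mem (X.measurableSet_flow k)]
      with ω hω hk hr
    by_cases hc : x / s < X.recentCount G T ω
    · exact Or.inl (lt_of_lt_of_le ((ofReal_lt_ofReal_mul_natCast hs hx _).2 hc) ((hω hk T).1 hr))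
    · exact Or.inr (not_lt.1 hc)
  calc _ ≤ (P[|{ω | X.I 0 ω = k}]).real
        ({ω | ENNReal.ofReal x < cost ω} ∪ {ω | (X.recentCount G T ω : ℝ) ≤ x / s}) :=
        ENNReal.toReal_mono (measure_ne_top _ _) (measure_mono_ae h1)
    _ ≤ _ := (measureReal_union_le _ _).trans (add_le_add le_rfl (X.cond_real_le k _))

/-- With disjoint lists the item almost surely determines the flow, so popularity among all requests
is `ν k` times popularity within the flow. -/
theorem pop_item_eq [IsProbabilityMeasure P] {X : RequestModel P D M} (hX : X.NonOverlapping)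
    (k : Fin M) (i : ℕ) :
    P.real {ω | (X.I 0 ω, X.R 0 ω) ∈ ({(k, X.item k i)} : Set (Fin M × D))} =
      X.pop (X.item k i) := by
  refine measureReal_congr ?_
  filter_upwards [X.request_mem 0] with ω ⟨j, hj⟩
  refine propext ?_
  change (X.I 0 ω, X.R 0 ω) = (k, X.item k i) ↔ X.R 0 ω = X.item k i
  rw [Prod.mk.injEq, and_iff_right_iff_imp]
  exact fun h => (hX.item_inj (hj.trans h)).1

theorem pop_item [IsProbabilityMeasure P] {X : RequestModel P D M} (hX : X.NonOverlapping)
    (k : Fin M) (i : ℕ) : X.pop (X.item k i) = X.ν k * X.q k i := by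
  rw [q, cond_real_eq, ← mul_assoc, mul_inv_cancel₀ (X.ν_pos k).ne', one_mul, ← pop_item_eq hX]
  congr 1
  ext ω
  simp

open Classical in
/-- The first `n` items of each of the flows `G`. -/
noncomputable def firstItems (X : RequestModel P D M) (G : Finset (Fin M)) (n : ℕ) :
    Finset D :=
  (G ×ˢ Finset.range n).image fun b => X.item b.1 b.2

theorem mem_firstItems {X : RequestModel P D M} {G : Finset (Fin M)} {n : ℕ} {d : D} :
    d ∈ X.firstItems G n ↔ ∃ g ∈ G, ∃ i < n, X.item g i = d := by
  classical
  simp only [firstItems, Finset.mem_image, Finset.mem_product, Finset.mem_range, Prod.exists]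
  constructor
  · rintro ⟨g, i, ⟨hg, hi⟩, h⟩
    exact ⟨g, hg, i, hi, h⟩
  · rintro ⟨g, hg, i, hi, h⟩
    exact ⟨g, i, ⟨hg, hi⟩, h⟩

theorem sum_firstItems {X : RequestModel P D M} (hX : X.NonOverlapping) (G : Finset (Fin M)) (n : ℕ)
    (f : D → ℝ) : ∑ d ∈ X.firstItems G n, f d = ∑ g ∈ G, ∑ i ∈ Finset.range n, f (X.item g i) := by
  classical
  rw [firstItems, Finset.sum_image fun a _ b _ h => ?_, Finset.sum_product]
  exact Prod.ext (hX.item_inj h).1 (hX.item_inj h).2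

theorem summable_pop_item [MeasurableSingletonClass D] [IsProbabilityMeasure P]
    (X : RequestModel P D M) (k : Fin M) :
    Summable fun i => X.pop (X.item k i) := by
  classical
  refine summable_of_sum_le (c := 1) (fun i => X.pop_nonneg _) fun u => ?_
  rw [← Finset.sum_image (s := u) (g := X.item k) (f := X.pop) fun i _ j _ h =>
    X.item_injective k h, ← measureReal_R_mem_finset]
  exact measureReal_le_one

theorem summable_one_sub_exp [MeasurableSingletonClass D] [IsProbabilityMeasure P]
    (X : RequestModel P D M) (k : Fin M) (T : ℕ) :
    Summable fun i => 1 - Real.exp (-(T * X.pop (X.item k i))) := by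
  refine Summable.of_nonneg_of_le (fun i => ?_) (fun i => ?_)
    ((X.summable_pop_item k).mul_left (T : ℝ))
  · have : Real.exp (-(T * X.pop (X.item k i))) ≤ 1 := Real.exp_le_one_iff.2 (by
      have := mul_nonneg T.cast_nonneg (X.pop_nonneg (X.item k i)); linarith)
    linarith
  · have := Real.add_one_le_exp (-(T * X.pop (X.item k i)))
    linarith

/-! ### Absence probabilities and Chernoff bounds for infinite lists. -/

section Countable

variable [MeasurableSingletonClass D] [Countable D] [IsProbabilityMeasure P]

theorem freshProb_eq_tsum {X : RequestModel P D M} (hX : X.NonOverlapping) (k : Fin M) (T : ℕ) :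
    X.freshProb k T =
      (X.ν k)⁻¹ * ∑' i, X.pop (X.item k i) * (1 - X.pop (X.item k i)) ^ T := by
  rw [freshProb, cond_real_eq]
  congr 1
  let E : ℕ → Set Ω := fun i =>
    {ω | (X.I 0 ω, X.R 0 ω) ∈ ({(k, X.item k i)} : Set (Fin M × D))} ∩ X.noHit {X.item k i} T
  have hE : ∀ i, P.real (E i) = X.pop (X.item k i) * (1 - X.pop (X.item k i)) ^ T := by
    intro i
    rw [measureReal_inter_noHit, pop_item_eq hX]
    rfl
  have hae : ({ω | X.I 0 ω = k} ∩ {ω | X.R 0 ω ∉ X.recent T ω} : Set Ω) =ᵐ[P] ⋃ i, E i := by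
    filter_upwards [X.request_mem 0] with ω ⟨j, hj⟩
    refine propext ?_
    change (X.I 0 ω = k ∧ X.R 0 ω ∉ X.recent T ω) ↔ ω ∈ ⋃ i, E i
    simp only [E, Set.mem_iUnion, Set.mem_inter_iff, mem_noHit_singleton, Set.mem_singleton_iff,
      Set.mem_ofPred_eq, Prod.mk.injEq]
    constructor
    · rintro ⟨rfl, h⟩
      exact ⟨j, ⟨rfl, hj.symm⟩, hj ▸ h⟩
    · rintro ⟨i, ⟨h1, h2⟩, h3⟩
      exact ⟨h1, h2 ▸ h3⟩
  have hmeas : ∀ i, MeasurableSet (E i) := fun i =>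
    (((X.measurable_I 0).prodMk (X.measurable_R 0))
      (Set.to_countable {(k, X.item k i)}).measurableSet).inter (X.measurableSet_noHit _ _)
  have hdisj : Pairwise (Function.onFun Disjoint E) := by
    intro i j hij
    refine Set.disjoint_left.2 fun ω h1 h2 => hij (X.item_injective k ?_)
    have e1 : (X.I 0 ω, X.R 0 ω) = (k, X.item k i) := h1.1
    have e2 : (X.I 0 ω, X.R 0 ω) = (k, X.item k j) := h2.1
    exact congrArg Prod.snd (e1.symm.trans e2)
  rw [measureReal_congr hae, measureReal_def, measure_iUnion hdisj hmeas,
    ENNReal.tsum_toReal_eq fun i => measure_ne_top _ _]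
  exact tsum_congr hE

/-- The finite Chernoff bound applies to the first `n` items of each flow, uniformly in `n`. The
events increase to one containing the event in question, since a finite set of recent items lies in
some truncation. -/
theorem measureReal_lt_recentCount_le {X : RequestModel P D M} (hX : X.NonOverlapping)
    (G : Finset (Fin M)) {w : ℝ} (hw : 1 < w) {T : ℕ} (hT : 0 < T) (y : ℝ) :
    P.real {ω | y < X.recentCount G T ω} ≤
      poissonLoss T * w ^ (-y) * Real.exp ((w - 1) * X.poissonMean G T) := by
  classical
  have hw0 : 0 < w := zero_lt_one.trans hw
  let E : ℕ → Set Ω := fun n => {ω | y < ((X.firstItems G n ∩ X.recent T ω).card : ℝ)}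
  have hmono : Monotone E := by
    intro n m hnm ω hω
    refine lt_of_lt_of_le (show y < _ from hω) (Nat.cast_le.2 (Finset.card_le_card
      (Finset.inter_subset_inter_right fun d hd => ?_)))
    obtain ⟨g, hg, i, hi, h⟩ := mem_firstItems.1 hd
    exact mem_firstItems.2 ⟨g, hg, i, hi.trans_le hnm, h⟩
  have hsub : {ω | y < (X.recentCount G T ω : ℝ)} ⊆ ⋃ n, E n := by
    intro ω hω
    have hd : ∀ d ∈ (X.recent T ω).filter (· ∈ X.itemsOf G), ∃ n, ∃ g ∈ G, X.item g n = d := by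
      intro d hd
      obtain ⟨g, hg, i, h⟩ := (Finset.mem_filter.1 hd).2
      exact ⟨i, g, hg, h⟩
    choose! f hf using hd
    refine Set.mem_iUnion.2 ⟨((X.recent T ω).filter (· ∈ X.itemsOf G)).sup f + 1, ?_⟩
    refine lt_of_lt_of_le (show y < _ from hω) (Nat.cast_le.2 (Finset.card_le_card fun d hd => ?_))
    obtain ⟨g, hg, h⟩ := hf d hd
    exact Finset.mem_inter.2 ⟨mem_firstItems.2 ⟨g, hg, f d,
      Nat.lt_succ_of_le (Finset.le_sup hd), h⟩, (Finset.mem_filter.1 hd).1⟩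
  have hbound : ∀ n, P.real (E n) ≤
      poissonLoss T * w ^ (-y) * Real.exp ((w - 1) * X.poissonMean G T) := by
    intro n
    refine (measureReal_mono fun ω hω => ?_).trans
      ((X.measureReal_rpow_le_pow_card_recent (X.firstItems G n) hw0 hT y).trans ?_)
    · exact Real.rpow_le_rpow_of_exponent_le hw.le (le_of_lt hω)
    · have hloss : 0 ≤ poissonLoss T := by unfold poissonLoss; positivity
      refine mul_le_mul_of_nonneg_left (Real.exp_le_exp.2 (mul_le_mul_of_nonneg_left ?_
        (by linarith))) (by positivity)
      rw [sum_firstItems hX]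
      refine Finset.sum_le_sum fun g _ =>
        (X.summable_one_sub_exp g T).sum_le_tsum _ fun i _ => ?_
      have : Real.exp (-(T * X.pop (X.item g i))) ≤ 1 := Real.exp_le_one_iff.2 (by
        have := mul_nonneg T.cast_nonneg (X.pop_nonneg (X.item g i)); linarith)
      linarith
  have hlim := (ENNReal.tendsto_toReal (measure_ne_top P _)).comp
    (tendsto_measure_iUnion_atTop (μ := P) hmono)
  exact (measureReal_mono hsub).trans (le_of_tendsto' hlim hbound)

/-- Truncating the lists only lowers the count, so the finite bound holds for every `n`, and `n → ∞`
is taken in the bound itself. -/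
theorem measureReal_recentCount_le_le {X : RequestModel P D M} (hX : X.NonOverlapping)
    (G : Finset (Fin M)) {w : ℝ} (hw0 : 0 < w) (hw : w < 1) {T : ℕ} (hT : 0 < T) (y : ℝ) :
    P.real {ω | (X.recentCount G T ω : ℝ) ≤ y} ≤
      poissonLoss T * w ^ (-y) * Real.exp ((w - 1) * X.poissonMean G T) := by
  classical
  have hbound : ∀ n, P.real {ω | (X.recentCount G T ω : ℝ) ≤ y} ≤
      poissonLoss T * w ^ (-y) * Real.exp ((w - 1) *
        ∑ g ∈ G, ∑ i ∈ Finset.range n, (1 - Real.exp (-(T * X.pop (X.item g i))))) := by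
    intro n
    rw [← sum_firstItems hX G n fun d => 1 - Real.exp (-(T * X.pop d))]
    refine (measureReal_mono fun ω hω => ?_).trans
      (X.measureReal_rpow_le_pow_card_recent (X.firstItems G n) hw0 hT y)
    refine Real.rpow_le_rpow_of_exponent_ge hw0 hw.le (le_trans (Nat.cast_le.2
      (Finset.card_le_card fun d hd => ?_)) (show (X.recentCount G T ω : ℝ) ≤ y from hω))
    obtain ⟨h1, h2⟩ := Finset.mem_inter.1 hd
    obtain ⟨g, hg, i, -, h⟩ := mem_firstItems.1 h1
    exact Finset.mem_filter.2 ⟨h2, g, hg, i, h⟩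
  have hlim : Tendsto (fun n : ℕ => poissonLoss T * w ^ (-y) * Real.exp ((w - 1) *
      ∑ g ∈ G, ∑ i ∈ Finset.range n, (1 - Real.exp (-(T * X.pop (X.item g i)))))) atTop
      (𝓝 (poissonLoss T * w ^ (-y) * Real.exp ((w - 1) * X.poissonMean G T))) := by
    refine Tendsto.const_mul _ ((Real.continuous_exp.tendsto _).comp (Tendsto.const_mul _ ?_))
    exact tendsto_finsetSum _ fun g _ => (X.summable_one_sub_exp g T).hasSum.tendsto_sum_nat
  exact ge_of_tendsto' hlim hbound

end Countable

end RequestModel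

/-! ### The choice of the horizon and the miss asymptotics. -/

/-- Stirling's sequence decreases from its first value `e / √2`, which gives the loss at most `e *
√T`; the cruder `e * T` suffices against an exponential gain. -/
theorem poissonLoss_le {T : ℕ} (hT : 0 < T) : poissonLoss T ≤ Real.exp 1 * T := by
  obtain ⟨n, rfl⟩ := Nat.exists_eq_succ_of_ne_zero hT.ne'
  have h := Stirling.stirlingSeq'_antitone (Nat.zero_le n)
  simp only [Function.comp] at h
  rw [show Nat.succ 0 = 1 from rfl, Stirling.stirlingSeq_one, Stirling.stirlingSeq] at h
  set T : ℝ := ((n.succ : ℕ) : ℝ) with hTdef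
  have hT1 : (1 : ℝ) ≤ T := by simp [hTdef]
  have hT0 : 0 < T := by linarith
  have hpos : 0 < √(2 * T) * (T / Real.exp 1) ^ n.succ := by positivity
  rw [div_le_iff₀ hpos] at h
  have hexp : Real.exp T = Real.exp 1 ^ n.succ := by rw [← Real.exp_nat_mul, mul_one]
  have hsq : √T ≤ T := Real.sqrt_le_iff.2 ⟨hT0.le, by nlinarith⟩
  rw [poissonLoss, ← hTdef, div_le_iff₀ (by positivity), hexp]
  have hE : (0 : ℝ) < Real.exp 1 ^ n.succ := by positivity
  calc (n.succ.factorial : ℝ) * Real.exp 1 ^ n.succ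
      ≤ Real.exp 1 / √2 * (√(2 * T) * (T / Real.exp 1) ^ n.succ) * Real.exp 1 ^ n.succ :=
        mul_le_mul_of_nonneg_right h hE.le
    _ = Real.exp 1 * √T * T ^ n.succ := by
        rw [Real.sqrt_mul (by norm_num), div_pow]
        have : (0 : ℝ) < √2 := by positivity
        field_simp
    _ ≤ Real.exp 1 * T * T ^ n.succ := by gcongr

section Horizon

variable {α θ : ℝ}

theorem tendsto_floor_rpow (hα : 1 < α) (hθ : 0 < θ) :
    Tendsto (fun y : ℝ => ⌊(θ * y) ^ α⌋₊) atTop atTop :=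
  tendsto_nat_floor_atTop.comp ((tendsto_rpow_atTop (by linarith)).comp
    (tendsto_id.const_mul_atTop hθ))

/-- The horizon `T = ⌊(θ * y) ^ α⌋₊` is chosen so that the mean count, of order `μ * T ^ (1 / α)`,
is about `θ * μ * y`: below the cache size `y` if `θ * μ < 1`, above it if `θ * μ > 1`. -/
theorem tendsto_floor_rpow_rpow_div (hα : 1 < α) (hθ : 0 < θ) :
    Tendsto (fun y : ℝ => (⌊(θ * y) ^ α⌋₊ : ℝ) ^ (1 / α) / y) atTop (𝓝 θ) := by
  have h0 : Tendsto (fun y : ℝ => (θ * y) ^ α) atTop atTop :=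
    (tendsto_rpow_atTop (by linarith)).comp (tendsto_id.const_mul_atTop hθ)
  have h1 := (((tendsto_nat_floor_div_atTop (R := ℝ)).comp h0).rpow_const (p := 1 / α)
    (Or.inl one_ne_zero)).const_mul θ
  rw [Real.one_rpow, mul_one] at h1
  refine h1.congr' ?_
  filter_upwards [eventually_gt_atTop 0] with y hy
  have hα0 : α ≠ 0 := by linarith
  simp only [Function.comp]
  rw [Real.div_rpow (Nat.cast_nonneg _) (by positivity), ← Real.rpow_mul (by positivity),
    mul_one_div_cancel hα0, Real.rpow_one]
  field_simp

theorem tendsto_rpow_mul_comp_floor (hα : 1 < α) (hθ : 0 < θ) {S : ℕ → ℝ} {σ : ℝ}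
    (hS : Tendsto (fun T : ℕ => (T : ℝ) ^ (1 - 1 / α) * S T) atTop (𝓝 σ)) :
    Tendsto (fun y : ℝ => y ^ (α - 1) * S ⌊(θ * y) ^ α⌋₊) atTop (𝓝 (σ * θ ^ (1 - α))) := by
  have h := (hS.comp (tendsto_floor_rpow hα hθ)).mul
    ((tendsto_floor_rpow_rpow_div hα hθ).rpow_const (p := 1 - α) (Or.inl hθ.ne'))
  refine h.congr' ?_
  filter_upwards [eventually_gt_atTop 0, (tendsto_floor_rpow hα hθ).eventually_gt_atTop 0]
    with y hy hT
  simp only [Function.comp]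
  set T := ⌊(θ * y) ^ α⌋₊
  have hT' : (0 : ℝ) < T := by exact_mod_cast hT
  have hα0 : α ≠ 0 := by linarith
  rw [Real.div_rpow (by positivity) hy.le, ← Real.rpow_mul hT'.le,
    show 1 / α * (1 - α) = -(1 - 1 / α) by field_simp; ring, Real.rpow_neg hT'.le,
    show α - 1 = -(1 - α) by ring, Real.rpow_neg hy.le]
  have h1 : (0 : ℝ) < (T : ℝ) ^ (1 - 1 / α) := by positivity
  field_simp

theorem tendsto_comp_floor_div (hα : 1 < α) (hθ : 0 < θ) {m : ℕ → ℝ} {μ : ℝ}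
    (hm : Tendsto (fun T : ℕ => (T : ℝ) ^ (-(1 / α)) * m T) atTop (𝓝 μ)) :
    Tendsto (fun y : ℝ => m ⌊(θ * y) ^ α⌋₊ / y) atTop (𝓝 (θ * μ)) := by
  have h := (tendsto_floor_rpow_rpow_div hα hθ).mul (hm.comp (tendsto_floor_rpow hα hθ))
  refine h.congr' ?_
  filter_upwards [eventually_gt_atTop 0, (tendsto_floor_rpow hα hθ).eventually_gt_atTop 0]
    with y hy hT
  simp only [Function.comp]
  set T := ⌊(θ * y) ^ α⌋₊
  have hT' : (0 : ℝ) < T := by exact_mod_cast hT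
  rw [Real.rpow_neg hT'.le]
  have h1 : (0 : ℝ) < (T : ℝ) ^ (1 / α) := by positivity
  field_simp

/-- The large deviations of the number of distinct items are negligible. -/
theorem tendsto_rpow_mul_chernoff (hα : 1 < α) (hθ : 0 < θ) {m : ℕ → ℝ} {μ : ℝ} (hμ : 0 < μ)
    (hm : Tendsto (fun T : ℕ => (T : ℝ) ^ (-(1 / α)) * m T) atTop (𝓝 μ)) (hne : θ * μ ≠ 1) (N : ℝ) :
    Tendsto (fun y : ℝ => y ^ (α - 1) * (N * (poissonLoss ⌊(θ * y) ^ α⌋₊ *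
      (2 / (1 + θ * μ)) ^ (-y) * Real.exp ((2 / (1 + θ * μ) - 1) * m ⌊(θ * y) ^ α⌋₊))))
      atTop (𝓝 0) := by
  set t := θ * μ with ht
  have ht0 : 0 < t := mul_pos hθ hμ
  -- This `w` lies above `1` exactly when `t < 1`, as the upper tail requires, and below `1` when `t
  -- > 1`. The inequality `log w ≥ 1 - 1 / w` then bounds the exponential rate below by `(1 - t) ^ 2
  -- / (2 * (1 + t))`.
  set w := 2 / (1 + t) with hw
  have hw0 : 0 < w := by positivity
  -- Half of the limiting rate; the other half absorbs the error in `m T / y → t`.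
  set κ := (Real.log w - (w - 1) * t) / 2 with hκ
  have hκ0 : 0 < κ := by
    have h1 := Real.one_sub_inv_le_log_of_pos hw0
    have h2 : 1 - w⁻¹ - (w - 1) * t = (1 - t) ^ 2 / (2 * (1 + t)) := by
      rw [hw]
      field_simp
      ring
    have h3 : 0 < (1 - t) ^ 2 := by
      have : 1 - t ≠ 0 := fun h => hne (by linarith)
      positivity
    have h4 : 0 < (1 - t) ^ 2 / (2 * (1 + t)) := by positivity
    rw [hκ]
    linarith
  have hlim : Tendsto (fun y : ℝ => (w - 1) * (m ⌊(θ * y) ^ α⌋₊ / y)) atTop (𝓝 ((w - 1) * t)) :=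
    (tendsto_comp_floor_div hα hθ hm).const_mul _
  have hlt : (w - 1) * t < Real.log w - κ := by rw [hκ] at hκ0 ⊢; linarith
  have hzero := (tendsto_rpow_mul_exp_neg_mul_atTop_nhds_zero (α - 1 + α) κ hκ0).const_mul
    (|N| * (Real.exp 1 * θ ^ α))
  rw [mul_zero] at hzero
  refine squeeze_zero_norm' ?_ hzero
  filter_upwards [eventually_gt_atTop 0, (tendsto_floor_rpow hα hθ).eventually_gt_atTop 0,
    hlim.eventually_lt_const hlt] with y hy hT hy2
  set T := ⌊(θ * y) ^ α⌋₊
  have hloss : 0 ≤ poissonLoss T := by unfold poissonLoss; positivity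
  have hT1 : (T : ℝ) ≤ θ ^ α * y ^ α := by
    rw [← Real.mul_rpow hθ.le hy.le]
    exact Nat.floor_le (by positivity)
  have hexp : w ^ (-y) * Real.exp ((w - 1) * m T) ≤ Real.exp (-κ * y) := by
    rw [Real.rpow_def_of_pos hw0, ← Real.exp_add, Real.exp_le_exp]
    have : (w - 1) * m T = (w - 1) * (m T / y) * y := by field_simp
    rw [this]
    nlinarith [mul_lt_mul_of_pos_right hy2 hy]
  rw [norm_mul, norm_mul, Real.norm_of_nonneg (by positivity : 0 ≤ y ^ (α - 1)), Real.norm_eq_abs N,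
    Real.norm_of_nonneg (by positivity), mul_assoc (poissonLoss T)]
  calc y ^ (α - 1) * (|N| * (poissonLoss T * (w ^ (-y) * Real.exp ((w - 1) * m T))))
      ≤ y ^ (α - 1) * (|N| * ((Real.exp 1 * (θ ^ α * y ^ α)) * Real.exp (-κ * y))) := by
        have := (poissonLoss_le hT).trans (mul_le_mul_of_nonneg_left hT1 (Real.exp_pos 1).le)
        gcongr
    _ = |N| * (Real.exp 1 * θ ^ α) * (y ^ (α - 1 + α) * Real.exp (-κ * y)) := by
        rw [Real.rpow_add hy]
        ring

end Horizon

/-- The asymptotics of a miss probability that is sandwiched between the probabilities that the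
requested item is not among the last `T` requests, up to Chernoff bounds. -/
theorem tendsto_rpow_mul_miss {α : ℝ} (hα : 1 < α) {miss : ℝ → ℝ} {S m : ℕ → ℝ} {N σ μ : ℝ}
    (hμ : 0 < μ)
    (hU : ∀ (y : ℝ) (T : ℕ) (w : ℝ), 0 ≤ y → 0 < T → 1 < w →
      miss y ≤ S T + N * (poissonLoss T * w ^ (-y) * Real.exp ((w - 1) * m T)))
    (hL : ∀ (y : ℝ) (T : ℕ) (w : ℝ), 0 ≤ y → 0 < T → 0 < w → w < 1 →
      S T ≤ miss y + N * (poissonLoss T * w ^ (-y) * Real.exp ((w - 1) * m T)))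
    (hS : Tendsto (fun T : ℕ => (T : ℝ) ^ (1 - 1 / α) * S T) atTop (𝓝 σ))
    (hm : Tendsto (fun T : ℕ => (T : ℝ) ^ (-(1 / α)) * m T) atTop (𝓝 μ)) :
    Tendsto (fun y : ℝ => y ^ (α - 1) * miss y) atTop (𝓝 (σ * μ ^ (α - 1))) := by
  -- Horizon parameter `θ` yields the value `σ * θ ^ (1 - α)`; continuity at the critical `θ = 1 /
  -- μ` lets the two one-sided bounds meet.
  have hcont : ContinuousAt (fun θ : ℝ => σ * θ ^ (1 - α)) μ⁻¹ :=
    continuousAt_const.mul (Real.continuousAt_rpow_const _ _ (Or.inl (by positivity)))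
  have hval : σ * μ⁻¹ ^ (1 - α) = σ * μ ^ (α - 1) := by
    rw [Real.inv_rpow hμ.le, ← Real.rpow_neg hμ.le, neg_sub]
  rw [ContinuousAt, hval] at hcont
  refine tendsto_order.2 ⟨fun a ha => ?_, fun a ha => ?_⟩
  · have h1 := ((hcont.mono_left nhdsWithin_le_nhds : Tendsto _ (𝓝[>] μ⁻¹) _).eventually_const_lt
      ha).and self_mem_nhdsWithin
    obtain ⟨θ, hθa, hθμ⟩ := h1.exists
    have hθμ : μ⁻¹ < θ := hθμ
    have hθ : 0 < θ := (inv_pos.2 hμ).trans hθμ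
    have ht : 1 < θ * μ := by rwa [inv_lt_iff_one_lt_mul₀ hμ] at hθμ
    have h2 := (tendsto_rpow_mul_comp_floor hα hθ hS).sub
      (tendsto_rpow_mul_chernoff hα hθ hμ hm ht.ne' N)
    rw [sub_zero] at h2
    filter_upwards [h2.eventually_const_lt hθa, eventually_gt_atTop 0,
      (tendsto_floor_rpow hα hθ).eventually_gt_atTop 0] with y hy hy0 hT
    have h3 := hL y _ (2 / (1 + θ * μ)) hy0.le hT (by positivity)
      ((div_lt_one (by positivity)).2 (by linarith))
    have h4 := mul_le_mul_of_nonneg_left h3 (by positivity : 0 ≤ y ^ (α - 1))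
    rw [mul_add] at h4
    linarith
  · have h0 : ∀ᶠ θ in 𝓝[<] μ⁻¹, 0 < θ :=
      mem_nhdsWithin_of_mem_nhds (lt_mem_nhds (inv_pos.2 hμ))
    have h1 := (((hcont.mono_left nhdsWithin_le_nhds :
      Tendsto _ (𝓝[<] μ⁻¹) _).eventually_lt_const ha).and self_mem_nhdsWithin).and h0
    obtain ⟨θ, ⟨hθa, hθμ⟩, hθ⟩ := h1.exists
    have hθμ : θ < μ⁻¹ := hθμ
    have ht : θ * μ < 1 := by rwa [← one_div, lt_div_iff₀ hμ] at hθμ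
    have h2 := (tendsto_rpow_mul_comp_floor hα hθ hS).add
      (tendsto_rpow_mul_chernoff hα hθ hμ hm ht.ne N)
    rw [add_zero] at h2
    filter_upwards [h2.eventually_lt_const hθa, eventually_gt_atTop 0,
      (tendsto_floor_rpow hα hθ).eventually_gt_atTop 0] with y hy hy0 hT
    have h3 := hU y _ (2 / (1 + θ * μ)) hy0.le hT
      ((one_lt_div (by positivity)).2 (by linarith))
    have h4 := mul_le_mul_of_nonneg_left h3 (by positivity : 0 ≤ y ^ (α - 1))
    rw [mul_add] at h4
    linarith

/-! ### The optimal fractions. -/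

/-- A quantitative tangent-line inequality for `r ^ (1 - α)` at `r = 1`, from `exp t ≥ 1 + t` and
`log r = 2 * log √r ≤ 2 * (√r - 1)`. The square makes the minimizer unique. -/
theorem mul_sqrt_sub_one_sq_le {α r : ℝ} (hα : 1 < α) (hr : 0 < r) :
    (α - 1) * (√r - 1) ^ 2 ≤ r ^ (1 - α) - 1 + (α - 1) * (r - 1) := by
  have h1 : 1 - (α - 1) * Real.log r ≤ r ^ (1 - α) := by
    rw [Real.rpow_def_of_pos hr]
    have := Real.add_one_le_exp (Real.log r * (1 - α))
    linarith
  have h2 : Real.log r ≤ 2 * (√r - 1) := by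
    have h3 := Real.log_le_sub_one_of_pos (Real.sqrt_pos.2 hr)
    rw [Real.log_sqrt hr.le] at h3
    linarith
  have h4 : (√r - 1) ^ 2 = r - 1 - 2 * (√r - 1) := by
    have := Real.sq_sqrt hr.le
    linear_combination this
  rw [h4]
  nlinarith [mul_le_mul_of_nonneg_left h2 (by linarith : 0 ≤ α - 1)]

theorem tendsto_rpow_mul_comp_mul {α : ℝ} {f : ℝ → ℝ} {l : ℝ}
    (hf : Tendsto (fun x : ℝ => x ^ (α - 1) * f x) atTop (𝓝 l)) {u : ℝ → ℝ} {v : ℝ} (hv : 0 < v)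
    (hu : Tendsto u atTop (𝓝 v)) :
    Tendsto (fun x : ℝ => x ^ (α - 1) * f (u x * x)) atTop (𝓝 (v ^ (1 - α) * l)) := by
  have h1 : Tendsto (fun x => u x * x) atTop atTop := hu.pos_mul_atTop hv tendsto_id
  have h2 := (hu.rpow_const (p := 1 - α) (Or.inl hv.ne')).mul (hf.comp h1)
  refine h2.congr' ?_
  filter_upwards [eventually_gt_atTop 0, hu.eventually_const_lt hv] with x hx hux
  simp only [Function.comp]
  rw [Real.mul_rpow hux.le hx.le, show 1 - α = -(α - 1) by ring, Real.rpow_neg hux.le]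
  have : 0 < u x ^ (α - 1) := by positivity
  field_simp

section Separation

variable {ι : Type*} [Fintype ι] {α K : ℝ} {a ν : ι → ℝ} {f : ι → ℝ → ℝ}

theorem tendsto_rpow_mul_sum_miss (ha : ∀ k, 0 < a k) (hν : ∀ k, 0 < ν k)
    (hf : ∀ k, Tendsto (fun x : ℝ => x ^ (α - 1) * f k x) atTop
      (𝓝 (K * (a k / ν k) * a k ^ (α - 1)))) {v : ι → ℝ} (hv : ∀ k, 0 < v k) :
    Tendsto (fun x : ℝ => x ^ (α - 1) * ∑ k, ν k * f k (v k * x)) atTop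
      (𝓝 (K * (∑ k, a k) ^ (α - 1) * ∑ k, a k * (v k * (∑ k, a k) / a k) ^ (1 - α))) := by
  have h := tendsto_finsetSum Finset.univ fun k _ =>
    (tendsto_rpow_mul_comp_mul (hf k) (hv k) tendsto_const_nhds).const_mul (ν k)
  rw [Finset.mul_sum]
  have e : ∀ k, ν k * (v k ^ (1 - α) * (K * (a k / ν k) * a k ^ (α - 1))) =
      K * (∑ k, a k) ^ (α - 1) * (a k * (v k * (∑ k, a k) / a k) ^ (1 - α)) := by
    intro k
    have hA : 0 < ∑ k, a k := Finset.sum_pos (fun k _ => ha k) ⟨k, Finset.mem_univ k⟩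
    have hνk := hν k
    have hak := ha k
    have hvk := hv k
    rw [Real.div_rpow (by positivity) hak.le, Real.mul_rpow hvk.le hA.le,
      show α - 1 = -(1 - α) by ring, Real.rpow_neg hA.le, Real.rpow_neg hak.le]
    have h1 : 0 < (∑ k, a k) ^ (1 - α) := by positivity
    have h2 : 0 < a k ^ (1 - α) := by positivity
    field_simp
  rw [← Finset.sum_congr rfl fun k _ => e k]
  refine h.congr fun x => ?_
  rw [Finset.mul_sum]
  exact Finset.sum_congr rfl fun k _ => by ring

/-- The tangent-line inequality at `r = (w j + η) * A / a j`, weighted by `a j`: the linear parts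
would cancel for fractions of sum `1`, and the enlargement by `η` leaves only the error proportional
to `η`. The shift keeps `r` positive when some `w j` vanishes. -/
theorem le_sum_mul_rpow (hα : 1 < α) (ha : ∀ k, 0 < a k) {w : ι → ℝ} (hw : w ∈ stdSimplex ℝ ι)
    {η : ℝ} (hη : 0 < η) (k : ι) :
    (∑ k, a k) + a k * ((α - 1) * (√((w k + η) * (∑ k, a k) / a k) - 1) ^ 2) -
      (α - 1) * ((∑ k, a k) * (Fintype.card ι * η)) ≤
      ∑ j, a j * ((w j + η) * (∑ k, a k) / a j) ^ (1 - α) := by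
  have hA : 0 < ∑ k, a k := Finset.sum_pos (fun k _ => ha k) ⟨k, Finset.mem_univ k⟩
  set A := ∑ k, a k
  have hr : ∀ j, 0 < (w j + η) * A / a j := fun j => by
    have := ha j
    have := hw.1 j
    positivity
  have h1 : ∀ j, a j + a j * ((α - 1) * (√((w j + η) * A / a j) - 1) ^ 2) -
      (α - 1) * (A * (w j + η) - a j) ≤ a j * ((w j + η) * A / a j) ^ (1 - α) := by
    intro j
    have h2 := mul_le_mul_of_nonneg_left (mul_sqrt_sub_one_sq_le hα (hr j)) (ha j).le
    have h3 : a j * ((w j + η) * A / a j) = A * (w j + η) := by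
      have := (ha j).ne'
      field_simp
    nlinarith
  refine le_trans ?_ (Finset.sum_le_sum fun j _ => h1 j)
  rw [Finset.sum_sub_distrib, Finset.sum_add_distrib, ← Finset.mul_sum, Finset.sum_sub_distrib,
    ← Finset.mul_sum, Finset.sum_add_distrib, hw.2, Finset.sum_const, Finset.card_univ,
    nsmul_eq_mul]
  have h4 : a k * ((α - 1) * (√((w k + η) * A / a k) - 1) ^ 2) ≤
      ∑ j, a j * ((α - 1) * (√((w j + η) * A / a j) - 1) ^ 2) :=
    Finset.single_le_sum (f := fun j => a j * ((α - 1) * (√((w j + η) * A / a j) - 1) ^ 2))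
      (fun j _ => mul_nonneg (ha j).le (mul_nonneg (by linarith) (sq_nonneg _))) (Finset.mem_univ k)
  have h5 : A * (1 + Fintype.card ι * η) - A = A * (Fintype.card ι * η) := by ring
  simp only [A] at h4 h5 ⊢
  rw [h5]
  linarith

/-- The miss probabilities with fractions proportional to `a`. -/
theorem tendsto_rpow_mul_sum_miss_proportional [Nonempty ι] (ha : ∀ k, 0 < a k) (hν : ∀ k, 0 < ν k)
    (hf : ∀ k, Tendsto (fun x : ℝ => x ^ (α - 1) * f k x) atTop
      (𝓝 (K * (a k / ν k) * a k ^ (α - 1)))) :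
    Tendsto (fun x : ℝ => x ^ (α - 1) * ∑ k, ν k * f k (a k / (∑ k, a k) * x)) atTop
      (𝓝 (K * (∑ k, a k) ^ (α - 1) * ∑ k, a k)) := by
  have hA : 0 < ∑ k, a k := Finset.sum_pos (fun k _ => ha k) Finset.univ_nonempty
  have h := tendsto_rpow_mul_sum_miss ha hν hf fun k => div_pos (ha k) hA
  have e : ∀ k, a k * (a k / (∑ k, a k) * (∑ k, a k) / a k) ^ (1 - α) = a k := by
    intro k
    rw [div_mul_cancel₀ _ hA.ne', div_self (ha k).ne', Real.one_rpow, mul_one]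
  simpa only [e] using h

theorem proportional_mem_stdSimplex [Nonempty ι] (ha : ∀ k, 0 < a k) :
    (fun k => a k / ∑ k, a k) ∈ stdSimplex ℝ ι := by
  have hA : 0 < ∑ k, a k := Finset.sum_pos (fun k _ => ha k) Finset.univ_nonempty
  exact ⟨fun k => (div_pos (ha k) hA).le, by rw [← Finset.sum_div, div_self hA.ne']⟩

theorem sum_miss_le_of_le (hν : ∀ k, 0 < ν k) (hanti : ∀ k, Antitone (f k)) {v w : ι → ℝ}
    (hvw : ∀ k, v k ≤ w k) {x : ℝ} (hx : 0 ≤ x) :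
    ∑ k, ν k * f k (w k * x) ≤ ∑ k, ν k * f k (v k * x) :=
  Finset.sum_le_sum fun k _ => mul_le_mul_of_nonneg_left
    (hanti k (mul_le_mul_of_nonneg_right (hvw k) hx)) (hν k).le

theorem proportional_optimal [Nonempty ι] (hα : 1 < α) (hK : 0 < K) (ha : ∀ k, 0 < a k)
    (hν : ∀ k, 0 < ν k) (hanti : ∀ k, Antitone (f k))
    (hf : ∀ k, Tendsto (fun x : ℝ => x ^ (α - 1) * f k x) atTop
      (𝓝 (K * (a k / ν k) * a k ^ (α - 1)))) {v : ι → ℝ} (hv : v ∈ stdSimplex ℝ ι) {ε : ℝ}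
    (hε : 0 < ε) :
    ∀ᶠ x in atTop, ∑ k, ν k * f k (a k / (∑ k, a k) * x) ≤
      (1 + ε) * ∑ k, ν k * f k (v k * x) := by
  have hA : 0 < ∑ k, a k := Finset.sum_pos (fun k _ => ha k) Finset.univ_nonempty
  set A := ∑ k, a k with hAdef
  -- The fractions `v` may vanish somewhere, where no asymptotics is available. Enlarging them by
  -- `η` only lowers the misses, and `ε` pays for the resulting loss in the lower bound.
  obtain ⟨η, hη, hηε⟩ : ∃ η > 0, 1 < (1 + ε) * (1 - (α - 1) * (Fintype.card ι * η)) := by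
    have hc : ContinuousAt (fun η : ℝ => (1 + ε) * (1 - (α - 1) * (Fintype.card ι * η))) 0 := by
      fun_prop
    have h1 : ∀ᶠ η in 𝓝 (0 : ℝ), 1 < (1 + ε) * (1 - (α - 1) * (Fintype.card ι * η)) := by
      refine hc.eventually_const_lt ?_
      simp [hε]
    have h2 : ∀ᶠ η in 𝓝[>] (0 : ℝ), 1 < (1 + ε) * (1 - (α - 1) * (Fintype.card ι * η)) :=
      mem_nhdsWithin_of_mem_nhds h1
    obtain ⟨η, h3, h4⟩ := (h2.and self_mem_nhdsWithin).exists
    exact ⟨η, h4, h3⟩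
  have h1 := tendsto_rpow_mul_sum_miss_proportional ha hν hf
  have h2 := (tendsto_rpow_mul_sum_miss ha hν hf (v := fun k => v k + η)
    fun k => add_pos_of_nonneg_of_pos (hv.1 k) hη).const_mul (1 + ε)
  have hlt : K * A ^ (α - 1) * A <
      (1 + ε) * (K * A ^ (α - 1) * ∑ k, a k * ((v k + η) * A / a k) ^ (1 - α)) := by
    obtain ⟨k⟩ := ‹Nonempty ι›
    have h3 := le_sum_mul_rpow hα ha hv hη k
    have h4 : 0 ≤ a k * ((α - 1) * (√((v k + η) * A / a k) - 1) ^ 2) :=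
      mul_nonneg (ha k).le (mul_nonneg (by linarith) (sq_nonneg _))
    have h5 : A * (1 - (α - 1) * (Fintype.card ι * η)) ≤
        ∑ k, a k * ((v k + η) * A / a k) ^ (1 - α) := by
      simp only [← hAdef] at h3
      linarith
    have hKA : 0 < K * A ^ (α - 1) := by positivity
    calc K * A ^ (α - 1) * A
        < K * A ^ (α - 1) * A * ((1 + ε) * (1 - (α - 1) * (Fintype.card ι * η))) :=
          lt_mul_of_one_lt_right (by positivity) hηε
      _ = (1 + ε) * (K * A ^ (α - 1) * (A * (1 - (α - 1) * (Fintype.card ι * η)))) := by ring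
      _ ≤ _ := by gcongr
  filter_upwards [h1.eventually_lt h2 hlt, eventually_gt_atTop 0] with x hx hx0
  have hp : 0 < x ^ (α - 1) := by positivity
  have h6 : ∑ k, ν k * f k (a k / A * x) ≤ (1 + ε) * ∑ k, ν k * f k ((v k + η) * x) := by
    rw [mul_left_comm] at hx
    exact (lt_of_mul_lt_mul_left hx hp.le).le
  refine h6.trans (mul_le_mul_of_nonneg_left ?_ (by linarith))
  exact sum_miss_le_of_le hν hanti (fun k => by linarith) hx0.le

theorem tendsto_of_optimal [Nonempty ι] (hα : 1 < α) (hK : 0 < K) (ha : ∀ k, 0 < a k)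
    (hν : ∀ k, 0 < ν k) (hanti : ∀ k, Antitone (f k))
    (hf : ∀ k, Tendsto (fun x : ℝ => x ^ (α - 1) * f k x) atTop
      (𝓝 (K * (a k / ν k) * a k ^ (α - 1)))) {u : ℝ → ι → ℝ}
    (hu : ∀ x, 0 < x → u x ∈ stdSimplex ℝ ι)
    (hopt : ∀ v ∈ stdSimplex ℝ ι, ∀ ε : ℝ, 0 < ε → ∀ᶠ x in atTop,
      ∑ k, ν k * f k (u x k * x) ≤ (1 + ε) * ∑ k, ν k * f k (v k * x)) :
    Tendsto u atTop (𝓝 fun k => a k / ∑ k, a k) := by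
  have hA : 0 < ∑ k, a k := Finset.sum_pos (fun k _ => ha k) Finset.univ_nonempty
  set A := ∑ k, a k with hAdef
  refine (isCompact_stdSimplex ℝ ι).tendsto_nhds_of_unique_mapClusterPt
    ((eventually_gt_atTop 0).mono hu) fun w hw hcl => funext fun k => ?_
  -- At a cluster point `w`, the fractions `u x` stay below `w + η` for arbitrarily large `x`, so by
  -- monotonicity `w + η` misses no more than `u x`, which is nearly as good as the proportional
  -- fractions. Letting `η → 0` kills the square.
  have key : ∀ η : ℝ, 0 < η → a k * ((α - 1) * (√((w k + η) * A / a k) - 1) ^ 2) ≤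
      A * η + (α - 1) * (A * (Fintype.card ι * η)) := by
    intro η hη
    have h1 := (tendsto_rpow_mul_sum_miss_proportional ha hν hf).const_mul (1 + η)
    have h2 := tendsto_rpow_mul_sum_miss ha hν hf (v := fun k => w k + η)
      fun k => add_pos_of_nonneg_of_pos (hw.1 k) hη
    have hle : K * A ^ (α - 1) * ∑ k, a k * ((w k + η) * A / a k) ^ (1 - α) ≤
        (1 + η) * (K * A ^ (α - 1) * A) := by
      by_contra hlt
      have h3 := h1.eventually_lt h2 (not_le.1 hlt)
      have hnear : ∀ᶠ v in 𝓝 w, ∀ j, v j < w j + η :=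
        eventually_all.2 fun j => (continuous_apply j).continuousAt.eventually_lt_const (by
          linarith)
      obtain ⟨x, hx1, hx2, hx3, hx4⟩ := ((hcl.frequently hnear).and_eventually
        (h3.and ((hopt _ (proportional_mem_stdSimplex ha) η hη).and
          (eventually_gt_atTop 0)))).exists
      have hp : 0 < x ^ (α - 1) := by positivity
      rw [mul_left_comm] at hx2
      have h4 := lt_of_mul_lt_mul_left hx2 hp.le
      have h5 := sum_miss_le_of_le hν hanti (fun j => (hx1 j).le) hx4.le
      linarith
    have h6 := le_sum_mul_rpow hα ha hw hη k
    simp only [← hAdef] at h6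
    have hKA : 0 < K * A ^ (α - 1) := by positivity
    rw [mul_left_comm] at hle
    have h7 := le_of_mul_le_mul_left hle hKA
    linarith
  have hlim1 : Tendsto (fun η : ℝ => a k * ((α - 1) * (√((w k + η) * A / a k) - 1) ^ 2)) (𝓝[>] 0)
      (𝓝 (a k * ((α - 1) * (√((w k + 0) * A / a k) - 1) ^ 2))) :=
    tendsto_nhdsWithin_of_tendsto_nhds (Continuous.tendsto (by fun_prop) _)
  have hlim2 : Tendsto (fun η : ℝ => A * η + (α - 1) * (A * (Fintype.card ι * η))) (𝓝[>] 0)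
      (𝓝 (A * 0 + (α - 1) * (A * (Fintype.card ι * 0)))) :=
    tendsto_nhdsWithin_of_tendsto_nhds (Continuous.tendsto (by fun_prop) _)
  have hle := le_of_tendsto_of_tendsto hlim1 hlim2 (eventually_mem_nhdsWithin.mono key)
  rw [add_zero, mul_zero, mul_zero, mul_zero, mul_zero, add_zero] at hle
  have hak := ha k
  have hsq : (√(w k * A / a k) - 1) ^ 2 = 0 := by
    refine le_antisymm ?_ (sq_nonneg _)
    by_contra hpos
    have h8 : 0 < a k * ((α - 1) * (√(w k * A / a k) - 1) ^ 2) :=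
      mul_pos hak (mul_pos (by linarith) (not_le.1 hpos))
    linarith
  have hone : √(w k * A / a k) = 1 := by
    have := pow_eq_zero_iff (two_ne_zero) |>.1 hsq
    linarith
  rw [Real.sqrt_eq_one, div_eq_one_iff_eq hak.ne'] at hone
  rw [eq_div_iff hA.ne', hone]

end Separation

/-! ### Miss probabilities of the model and conclusion. -/

namespace RequestModel

variable {Ω : Type*} [MeasurableSpace Ω] {P : Measure Ω} {D : Type*} [MeasurableSpace D] {M : ℕ} [IsProbabilityMeasure P]

theorem isEquivalent_pop_item {X : RequestModel P D M} (hX : X.NonOverlapping) {α : ℝ}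
    {c : Fin M → ℝ} {k : Fin M} (hq : X.q k ~[atTop] fun i : ℕ => c k / ((i : ℝ) + 1) ^ α) :
    (fun i => X.pop (X.item k i)) ~[atTop] fun i : ℕ => X.ν k * c k / ((i : ℝ) + 1) ^ α := by
  have h := (IsEquivalent.refl (u := fun _ : ℕ => X.ν k) (l := atTop)).mul hq
  refine (h.congr_left (.of_forall fun i => ?_)).congr_right (.of_forall fun i => ?_)
  · exact (pop_item hX k i).symm
  · exact (mul_div_assoc _ _ _).symm

theorem CostBounds.tendsto_miss [MeasurableSingletonClass D] [Countable D]
    {X : RequestModel P D M} (hX : X.NonOverlapping) {s : ℝ}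
    (hs : 0 < s) {α : ℝ} (hα : 1 < α) {c : Fin M → ℝ} (hc : ∀ k, 0 < c k)
    (hq : ∀ k, X.q k ~[atTop] fun i : ℕ => c k / ((i : ℝ) + 1) ^ α) {k : Fin M}
    {G : Finset (Fin M)} (hG : G.Nonempty) {cost : Ω → ℝ≥0∞} (h : X.CostBounds s k G cost) :
    Tendsto (fun x : ℝ =>
        x ^ (α - 1) * (P[|{ω | X.I 0 ω = k}]).real {ω | ENNReal.ofReal x < cost ω}) atTop
      (𝓝 (s ^ (α - 1) * (∫ z in Set.Ioi (0 : ℝ), z ^ (-α) * Real.exp (-(z ^ (-α)))) *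
        (∫ z in Set.Ioi (0 : ℝ), (1 - Real.exp (-(z ^ (-α))))) ^ (α - 1) *
        ((X.ν k * c k) ^ (1 / α) / X.ν k) * (∑ g ∈ G, (X.ν g * c g) ^ (1 / α)) ^ (α - 1))) := by
  set L := ∫ z in Set.Ioi (0 : ℝ), (1 - Real.exp (-(z ^ (-α)))) with hLdef
  set J := ∫ z in Set.Ioi (0 : ℝ), z ^ (-α) * Real.exp (-(z ^ (-α)))
  have hL : 0 < L := integral_one_sub_exp_pos hα
  have hνc : ∀ g, 0 < X.ν g * c g := fun g => mul_pos (X.ν_pos g) (hc g)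
  have hW : 0 < ∑ g ∈ G, (X.ν g * c g) ^ (1 / α) :=
    Finset.sum_pos (fun g _ => Real.rpow_pos_of_pos (hνc g) _) hG
  set W := ∑ g ∈ G, (X.ν g * c g) ^ (1 / α) with hWdef
  have hS : Tendsto (fun T : ℕ => (T : ℝ) ^ (1 - 1 / α) * X.freshProb k T) atTop
      (𝓝 ((X.ν k)⁻¹ * ((X.ν k * c k) ^ (1 / α) * J))) := by
    have h1 := (tendsto_tsum_mul_one_sub_pow hα (fun i => X.pop_nonneg (X.item k i))
      (fun i => X.pop_le_one _) (hνc k) (isEquivalent_pop_item hX (hq k))).const_mul (X.ν k)⁻¹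
    refine h1.congr fun T => ?_
    rw [freshProb_eq_tsum hX, mul_left_comm]
  have hm : Tendsto (fun T : ℕ => (T : ℝ) ^ (-(1 / α)) * X.poissonMean G T) atTop (𝓝 (W * L)) := by
    have h1 := tendsto_finsetSum G fun g _ =>
      tendsto_tsum_one_sub_exp hα (fun i => X.pop_nonneg (X.item g i))
        (fun i => X.pop_le_one _) (hνc g) (isEquivalent_pop_item hX (hq g))
    rw [hWdef, Finset.sum_mul]
    refine h1.congr fun T => ?_
    rw [poissonMean, Finset.mul_sum]
  have hν := inv_nonneg.2 (X.ν_pos k).le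
  -- Cache space is measured in items here; undoing this scaling produces the factor `s ^ (α - 1)`.
  have key := tendsto_rpow_mul_miss hα
    (miss := fun y => (P[|{ω | X.I 0 ω = k}]).real {ω | ENNReal.ofReal (s * y) < cost ω})
    (N := (X.ν k)⁻¹) (mul_pos hW hL) ?_ ?_ hS hm
  · have h2 := (key.comp (tendsto_id.atTop_mul_const (inv_pos.2 hs))).const_mul (s ^ (α - 1))
    have hval : s ^ (α - 1) * ((X.ν k)⁻¹ * ((X.ν k * c k) ^ (1 / α) * J) * (W * L) ^ (α - 1)) =
        s ^ (α - 1) * J * L ^ (α - 1) * ((X.ν k * c k) ^ (1 / α) / X.ν k) * W ^ (α - 1) := by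
      rw [Real.mul_rpow hW.le hL.le]
      ring
    rw [hval] at h2
    refine h2.congr' ?_
    filter_upwards [eventually_gt_atTop 0] with x hx
    simp only [Function.comp, id]
    rw [← mul_assoc, ← Real.mul_rpow hs.le (by positivity), mul_left_comm s,
      mul_inv_cancel₀ hs.ne', mul_one]
  · intro y T w hy hT hw
    have h1 := h.miss_le hs (mul_nonneg hs.le hy) T
    rw [mul_div_cancel_left₀ _ hs.ne'] at h1
    exact h1.trans (add_le_add le_rfl (mul_le_mul_of_nonneg_left
      (measureReal_lt_recentCount_le hX G hw hT y) hν))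
  · intro y T w hy hT hw0 hw
    have h1 := h.le_miss hs (mul_nonneg hs.le hy) T
    rw [mul_div_cancel_left₀ _ hs.ne'] at h1
    exact h1.trans (add_le_add le_rfl (mul_le_mul_of_nonneg_left
      (measureReal_recentCount_le_le hX G hw0 hw hT y) hν))

end RequestModel

theorem corollary4 {Ω D : Type*} [MeasurableSpace Ω] {P : Measure Ω} [IsProbabilityMeasure P]
    [MeasurableSpace D] [MeasurableSingletonClass D] [Countable D] {M : ℕ}
    (X : RequestModel P D M) (hX : X.NonOverlapping)
    (s : ℝ) (hs : ∀ k i, X.size (X.item k i) = s)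
    (α : ℝ) (hα : 1 < α) (c : Fin M → ℝ) (hc : ∀ k, 0 < c k)
    (hq : ∀ k, X.q k ~[atTop] fun i : ℕ => c k / ((i : ℝ) + 1) ^ α) :
    (∃ v : Fin M → ℝ, X.IsOptimalSeparation fun _ => v) ∧
    ∀ u : ℝ → Fin M → ℝ, X.IsOptimalSeparation u →
      (∀ k, Tendsto (fun x : ℝ => X.poolMiss k x / X.sepMiss k (u x k * x)) atTop (𝓝 1)) ∧
      ∀ i j,
        Tendsto (fun x : ℝ => X.poolMiss i x / X.poolMiss j x) atTop
          (𝓝 ((c i ^ (1 / α) * X.ν i ^ (1 / α - 1)) / (c j ^ (1 / α) * X.ν j ^ (1 / α - 1)))) ∧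
        Tendsto (fun x : ℝ => X.sepMiss i (u x i * x) / X.sepMiss j (u x j * x)) atTop
          (𝓝 ((c i ^ (1 / α) * X.ν i ^ (1 / α - 1)) / (c j ^ (1 / α) * X.ν j ^ (1 / α - 1)))) := by
  obtain ⟨ω₀⟩ := nonempty_of_isProbabilityMeasure P
  have : Nonempty (Fin M) := ⟨X.I 0 ω₀⟩
  -- A probability space has a point, hence there is a flow with an item, whose size is positive.
  have hs0 : 0 < s := hs (X.I 0 ω₀) 0 ▸ X.size_pos _
  have hν := X.ν_pos
  set a : Fin M → ℝ := fun k => (X.ν k * c k) ^ (1 / α) with hadef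
  have ha : ∀ k, 0 < a k := fun k => Real.rpow_pos_of_pos (mul_pos (hν k) (hc k)) _
  have hA : 0 < ∑ k, a k := Finset.sum_pos (fun k _ => ha k) Finset.univ_nonempty
  set K : ℝ := s ^ (α - 1) * (∫ z in Set.Ioi (0 : ℝ), z ^ (-α) * Real.exp (-(z ^ (-α)))) *
    (∫ z in Set.Ioi (0 : ℝ), (1 - Real.exp (-(z ^ (-α))))) ^ (α - 1)
  have hK : 0 < K := mul_pos (mul_pos (Real.rpow_pos_of_pos hs0 _) (integral_mul_exp_pos hα))
    (Real.rpow_pos_of_pos (integral_one_sub_exp_pos hα) _)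
  have hpool : ∀ k, Tendsto (fun x : ℝ => x ^ (α - 1) * X.poolMiss k x) atTop
      (𝓝 (K * (a k / X.ν k) * (∑ k, a k) ^ (α - 1))) := fun k =>
    (RequestModel.costBounds_poolCost hX hs k).tendsto_miss hX hs0 hα hc hq Finset.univ_nonempty
  have hsep : ∀ k, Tendsto (fun x : ℝ => x ^ (α - 1) * X.sepMiss k x) atTop
      (𝓝 (K * (a k / X.ν k) * a k ^ (α - 1))) := by
    intro k
    have h := (RequestModel.costBounds_sepCost hX hs k).tendsto_miss hX hs0 hα hc hq
      (Finset.singleton_nonempty k)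
    rwa [Finset.sum_singleton] at h
  have hanti := X.sepMiss_antitone
  have hratio : ∀ k, a k / X.ν k = c k ^ (1 / α) * X.ν k ^ (1 / α - 1) := by
    intro k
    rw [hadef, Real.rpow_sub_one (hν k).ne']
    simp only
    rw [Real.mul_rpow (hν k).le (hc k).le]
    ring
  have hquot : ∀ {f g : ℝ → ℝ} {l m : ℝ}, m ≠ 0 →
      Tendsto (fun x : ℝ => x ^ (α - 1) * f x) atTop (𝓝 l) →
      Tendsto (fun x : ℝ => x ^ (α - 1) * g x) atTop (𝓝 m) →
      Tendsto (fun x => f x / g x) atTop (𝓝 (l / m)) := by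
    intro f g l m hm hf hg
    refine (hf.div hg hm).congr' ?_
    filter_upwards [eventually_gt_atTop 0] with x hx
    exact mul_div_mul_left _ _ (by positivity)
  have hlpos : ∀ k, 0 < K * (a k / X.ν k) * (∑ k, a k) ^ (α - 1) := fun k => by
    have := hν k
    have := ha k
    positivity
  have hlratio : ∀ i j, K * (a i / X.ν i) * (∑ k, a k) ^ (α - 1) /
      (K * (a j / X.ν j) * (∑ k, a k) ^ (α - 1)) =
      (c i ^ (1 / α) * X.ν i ^ (1 / α - 1)) / (c j ^ (1 / α) * X.ν j ^ (1 / α - 1)) := by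
    intro i j
    rw [mul_div_mul_right _ _ (by positivity), mul_div_mul_left _ _ hK.ne', hratio, hratio]
  refine ⟨⟨fun k => a k / ∑ k, a k, fun _ _ => proportional_mem_stdSimplex ha,
    fun v hv ε hε => ?_⟩, fun u hu => ?_⟩
  · simp only [X.overallSepMiss_eq_sum]
    exact proportional_optimal hα hK ha hν hanti hsep hv hε
  · have hlim : Tendsto u atTop (𝓝 fun k => a k / ∑ k, a k) := by
      refine tendsto_of_optimal hα hK ha hν hanti hsep hu.1 ?_
      simpa only [X.overallSepMiss_eq_sum] using hu.2
    have hsepu : ∀ k, Tendsto (fun x : ℝ => x ^ (α - 1) * X.sepMiss k (u x k * x)) atTop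
        (𝓝 (K * (a k / X.ν k) * (∑ k, a k) ^ (α - 1))) := by
      intro k
      have h := tendsto_rpow_mul_comp_mul (hsep k) (div_pos (ha k) hA) (tendsto_pi_nhds.1 hlim k)
      -- Scaling the cache by `a k / A` turns the factor `a k ^ (α - 1)` into `A ^ (α - 1)`, the
      -- factor of the pooled cache.
      have hval : (a k / ∑ k, a k) ^ (1 - α) * (K * (a k / X.ν k) * a k ^ (α - 1)) =
          K * (a k / X.ν k) * (∑ k, a k) ^ (α - 1) := by
        rw [Real.div_rpow (ha k).le hA.le, show 1 - α = -(α - 1) by ring,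
          Real.rpow_neg (ha k).le, Real.rpow_neg hA.le]
        have := Real.rpow_pos_of_pos (ha k) (α - 1)
        have := Real.rpow_pos_of_pos hA (α - 1)
        field_simp
      rwa [hval] at h
    refine ⟨fun k => ?_, fun i j => ⟨?_, ?_⟩⟩
    · have h := hquot (hlpos k).ne' (hpool k) (hsepu k)
      rwa [div_self (hlpos k).ne'] at h
    · have h := hquot (hlpos j).ne' (hpool i) (hpool j)
      rwa [hlratio] at h
    · have h := hquot (hlpos j).ne' (hsepu i) (hsepu j)
      rwa [hlratio] at h
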